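/- **Setting.** Let $\mathfrak b\in[0,\frac12]$ and let $S(\beta)=\dfrac{\sinh\beta-\mathrm i\sin 2\pi\mathfrak b}{\sinh\beta+\mathrm i\sin 2\pi\mathfrak b}$ be the Sinh-Gordon S-matrix (understood as the constant $1$ when $\sin 2\pi\mathfrak b=0$). Let $m>0$, let $\boldsymbol p(\beta)=(m\cosh\beta,m\sinh\beta)$, $\overline{\boldsymbol p}(\boldsymbol A)=\sum_{\alpha\in A}\boldsymbol p(\alpha)$, and let $\boldsymbol x\cdot\boldsymbol y=x_0y_0-x_1y_1$ on $\mathbb R^{1,1}$. Let $k\ge 1$ and let $O_1,\dots,O_k$ be operators with form factors $\mathcal F^{(O_p)}=(\mathcal F^{(O_p)}_n)_{n\ge0}$, i.e. solutions of the bootstrap axioms I–IV (meromorphy, with regular boundary values at real rapidities; exchange $\mathcal F_n(\dots,\beta_a,\beta_{a+1},\dots)=S(\beta_a-\beta_{a+1})\mathcal F_n(\dots,\beta_{a+1},\beta_a,\dots)$; quasi-periodicity with phase $e^{2\mathrm i\pi\omega_{O_p}}$; residue equation at the only poles, which are simple and lie at $\mathrm i\pi$-shifted rapidities; boost covariance;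 growth bound). Let $G$ be a Schwartz function on $(\mathbb R^{1,1})^k$ and let $0<\varepsilon_p<\pi$. For $0\le p\le k$ let $A^{(p)}=\{\alpha^{(p)}_a\}_{a=1}^{r_p}$ be real variables, with $A^{(0)}=\emptyset$. For a set $X$ of variables of one level, $\boldsymbol X$ is the vector of its elements ordered by index, $\overleftarrow{\boldsymbol X}$ the reversed vector, and $\vec{\boldsymbol X}^{\,\sigma}$ the vector $\boldsymbol X$ with entries permuted by $\sigma$; $\boldsymbol X\cup\boldsymbol Y$ is concatenation, and $\overrightarrow{(\boldsymbol X\cup\boldsymbol Y)}^{\,\sigma}$ the index ordered vector of the set $X\cup Y$, permuted by $\sigma$. If $\boldsymbol Y$ is a reordering of $\boldsymbol X$, then $S(\boldsymbol X\mid\boldsymbol Y)$ is the product of the factors $S(u-v)$ over all pairs of entries with $u$ before $v$ in $\boldsymbol X$ and $v$ before $u$ in $\boldsymbol Y$. For vectors of equal length, $\Delta(\boldsymbol X\mid\boldsymbol Y)=\prod_a 2\pi\,\delta(X_a-Y_a)$. Put $\overline{\boldsymbol e}_\varepsilon=(1-\frac{\varepsilon}{\pi})(1,\dots,1)$, $\boldsymbol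 x_{us}=\boldsymbol x_u-\boldsymbol x_s$. The regularised kernels are $$\mathcal M^{(O_\ell)}(\boldsymbol A^{(\ell-1)};\boldsymbol A^{(\ell)})_{\varepsilon}=e^{-2\mathrm i\pi\omega_{O_\ell}|A^{(\ell-1)}|}\sum\Delta(\boldsymbol A_1\mid\boldsymbol B_1)\,S(\overleftarrow{\boldsymbol A^{(\ell-1)}}\mid\overleftarrow{\boldsymbol A_2}\cup\overleftarrow{\boldsymbol A_1})\,S(\boldsymbol A^{(\ell)}\mid\boldsymbol B_1\cup\boldsymbol B_2)\,\mathcal F^{(O_\ell)}(\overleftarrow{\boldsymbol A_2}+\mathrm i\pi\overline{\boldsymbol e}_\varepsilon,\boldsymbol B_2),$$ the sum running over partitions $A^{(\ell-1)}=A_1\cup A_2$ and $A^{(\ell)}=B_1\cup B_2$ with $|A_1|=|B_1|$, where the elements of $B_1$ are in addition labelled in an arbitrary order. Let $$\mathcal G_{\rm tot}[G]=\prod_{\ell=1}^k\mathcal M^{(O_\ell)}(\boldsymbol A^{(\ell-1)};\boldsymbol A^{(\ell)})_{\varepsilon_\ell}\cdot\int\prod_{s=1}^k d\boldsymbol x_s\;G(\boldsymbol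 x_1,\dots,\boldsymbol x_k)\,e^{\mathrm i\{\overline{\boldsymbol p}(\boldsymbol A^{(0)})\cdot\boldsymbol x_1+\sum_{p=1}^{k-1}\overline{\boldsymbol p}(\boldsymbol A^{(p)})\cdot\boldsymbol x_{p+1\,p}-\overline{\boldsymbol p}(\boldsymbol A^{(k)})\cdot\boldsymbol x_k\}}.$$ **Proposition.** Both sides of the following equation are well-defined distributions in the variables $\boldsymbol A^{(1)},\dots,\boldsymbol A^{(k)}$ (sums of products of Dirac masses with coefficients that are locally integrable with respect to them), and they coincide when paired with any smooth compactly supported function of these variables: $$\mathcal G_{\rm tot}[G]=\prod_{s=1}^k e^{-2\mathrm i\pi\omega_{O_s}|A^{(s-1)}|}\sum_{\text{partitions}}\ \sum_{\sigma}\ \mathscr S\cdot\prod_{p=2}^{k-1}\prod_{s=1}^{p-1}\Delta\Big(\boldsymbol A_s^{(p-1)}\,\Big|\,\overrightarrow{\big(\boldsymbol A_s^{(p)}\cup\boldsymbol\gamma^{(p+1\,s)}\big)}^{\,\sigma_s^{(p-1)}}\Big)\prod_{s=1}^{k-1}\Delta\big(\boldsymbol A_s^{(k-1)}\mid\boldsymbol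 B_s^{(k)}\big)$$ $$\times\prod_{p=1}^k\mathcal F^{(O_p)}\Big(\overleftarrow{\boldsymbol\gamma^{(p\,p-1)}}\cup\dots\cup\overleftarrow{\boldsymbol\gamma^{(p1)}}+\mathrm i\pi\overline{\boldsymbol e}_{\varepsilon_p},\ \boldsymbol B_p^{(k)}\cup\boldsymbol\gamma^{(kp)}\cup\dots\cup\boldsymbol\gamma^{(p+1\,p)}\Big)\cdot\mathscr R[G].$$ The sums run over partitions into (possibly empty) blocks $A^{(p)}=\bigcup_{s=1}^pA_s^{(p)}\cup\bigcup_{s=1}^p\gamma^{(p+1\,s)}$ for $1\le p\le k-1$ and $A^{(k)}=\bigcup_{s=1}^kB_s^{(k)}$, the elements of $B_1^{(k)},\dots,B_{k-1}^{(k)}$ being labelled in an arbitrary order and those of $B_k^{(k)}$ being index ordered, and over permutations $\sigma_s^{(p-1)}\in\mathfrak S_{|A_s^{(p-1)}|}$, $1\le s\le p-1$, $2\le p\le k-1$, under the constraints $|A_s^{(p-1)}|=|A_s^{(p)}\cup\gamma^{(p+1\,s)}|$ for $1\le s\le p-1$, $2\le p\le k-1$, and $|A_s^{(k-1)}|=|B_s^{(k)}|$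 for $1\le s\le k-1$. Moreover $$\mathscr S=S\big(\boldsymbol A^{(k)}\mid\boldsymbol B_1^{(k)}\cup\dots\cup\boldsymbol B_k^{(k)}\big)\prod_{p=2}^{k-1}\prod_{s=1}^{p-1}\prod_{v=s+1}^{p}S\big(\boldsymbol B_v^{(k)}\cup\boldsymbol\gamma^{(p+1\,s)}\mid\boldsymbol\gamma^{(p+1\,s)}\cup\boldsymbol B_v^{(k)}\big)\prod_{p=3}^{k}\prod_{v=p+1}^{k}\ \prod_{1\le s<u\le p-1}S\big(\boldsymbol\gamma^{(vu)}\cup\boldsymbol\gamma^{(ps)}\mid\boldsymbol\gamma^{(ps)}\cup\boldsymbol\gamma^{(vu)}\big),$$ $$\mathscr R[G]=\int_{(\mathbb R^{1,1})^k}\prod_{s=1}^kd\boldsymbol x_s\,G(\boldsymbol x_1,\dots,\boldsymbol x_k)\exp\Big\{\mathrm i\sum_{1\le s<u\le k}\overline{\boldsymbol p}(\boldsymbol\gamma^{(us)})\cdot\boldsymbol x_{us}-\mathrm i\sum_{s=1}^k\overline{\boldsymbol p}(\boldsymbol B_s^{(k)})\cdot\boldsymbol x_s\Big\}.$$ -/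

import Mathlib

open scoped SchwartzMap

namespace ShG

noncomputable section

/-! ### S-matrix and form factors of the Sinh-Gordon model -/

/-- The scalar S-matrix `S(β) = (sinh β - i sin 2πb) / (sinh β + i sin 2πb)`.  When `sin 2πb = 0`
(free theory) this meromorphic function is the constant `1`, also at its removable points. -/
def sMat (b : ℝ) (β : ℂ) : ℂ :=
  if Real.sin (2 * Real.pi * b) = 0 then 1
  else (Complex.sinh β - Complex.I * Real.sin (2 * Real.pi * b)) /
    (Complex.sinh β + Complex.I * Real.sin (2 * Real.pi * b))

/-- The rapidity strip `0 < Im z < 2π`. -/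
def strip : Set ℂ := {z | 0 < z.im ∧ z.im < 2 * Real.pi}

/-- `F n` (`n = 0, 1, 2, …`) are the form factors of an operator with mutual locality exponent `ω`,
spin `s` and growth index `w`: a solution of the form factor bootstrap axioms for the S-matrix
`sMat b`.  The `F n` are meromorphic functions of `n` complex variables, written here as total
functions with arbitrary values on the polar set; `AnalyticAt ℂ (F n) β` says that `β` is a regular
point, and every functional equation is an equation of meromorphic functions, stated at regular or
generic points. -/
structure IsFormFactor (b ω : ℝ) (s : ℂ) (w : ℝ) (F : (n : ℕ) → (Fin n → ℂ) → ℂ) : Prop where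
  /-- meromorphic in each variable, the others being fixed in generic position in the strip -/
  meromorphic : ∀ (n : ℕ) (k : Fin n) (β : Fin n → ℂ),
    (∀ a, a ≠ k → β a ∈ strip) →
    (∀ a c, a ≠ k → c ≠ k → a ≠ c → (β a).re ≠ (β c).re) →
    MeromorphicOn (fun z => F n (Function.update β k z)) strip
  /-- growth at infinity in each variable -/
  growth : ∀ (n : ℕ) (k : Fin n) (β : Fin n → ℂ),
    (∀ a, a ≠ k → β a ∈ strip) →
    (∀ a c, a ≠ k → c ≠ k → a ≠ c → (β a).re ≠ (β c).re) →
    ∃ C R : ℝ, ∀ z ∈ strip, R ≤ |z.re| →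
      ‖F n (Function.update β k z)‖ ≤ C * Real.cosh (w * z.re)
  /-- the only poles are at rapidities differing by `iπ`; in particular the boundary values at real
  rapidities are regular.  The imaginary parts are taken in decreasing order, the other orders being
  reached by the exchange axiom. -/
  regular : ∀ (n : ℕ) (β : Fin n → ℂ),
    (∀ a c, a < c → 0 ≤ (β a - β c).im ∧ (β a - β c).im < 2 * Real.pi) →
    (∀ a c, a < c → β a - β c ≠ Real.pi * Complex.I) →
    AnalyticAt ℂ (F n) β
  /-- axiom I: exchange of two neighbouring rapidities -/
  exchange : ∀ (n : ℕ) (β : Fin n → ℂ) (a c : Fin n), (a : ℕ) + 1 = c →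
    AnalyticAt ℂ (F n) β → AnalyticAt ℂ (F n) (β ∘ Equiv.swap a c) →
    Complex.sinh (β a - β c) + Complex.I * Real.sin (2 * Real.pi * b) ≠ 0 →
    F n β = sMat b (β a - β c) * F n (β ∘ Equiv.swap a c)
  /-- axiom II: quasi-periodicity -/
  cyclic : ∀ (n : ℕ) (β₁ : ℝ) (β' : Fin n → ℂ), (∀ a, β' a ∈ strip) →
    AnalyticAt ℂ (F (n + 1)) (Fin.cons ((β₁ : ℂ) + 2 * Real.pi * Complex.I) β' : Fin (n + 1) → ℂ) →
    AnalyticAt ℂ (F (n + 1)) (Fin.snoc β' (β₁ : ℂ) : Fin (n + 1) → ℂ) →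
    F (n + 1) (Fin.cons ((β₁ : ℂ) + 2 * Real.pi * Complex.I) β' : Fin (n + 1) → ℂ) =
      Complex.exp (2 * Complex.I * Real.pi * ω) * F (n + 1) (Fin.snoc β' (β₁ : ℂ) : Fin (n + 1) → ℂ)
  /-- axiom III: the poles are simple, with residues fixed by the form factors with two rapidities
  less -/
  residue : ∀ (n : ℕ) (β : ℂ) (β' : Fin n → ℂ), 0 < β.im → β.im < Real.pi →
    (∀ a, β' a ∈ strip) → (∀ a, (β' a).re ≠ β.re) → (∀ a c, a ≠ c → (β' a).re ≠ (β' c).re) →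
    Filter.Tendsto
      (fun α : ℂ => -Complex.I * ((α - β) * F (n + 2)
        (Fin.cons (α + Real.pi * Complex.I) (Fin.cons β β' : Fin (n + 1) → ℂ) : Fin (n + 2) → ℂ)))
      (nhdsWithin β {β}ᶜ)
      (nhds ((1 - Complex.exp (2 * Complex.I * Real.pi * ω) * ∏ a, sMat b (β - β' a)) * F n β'))
  /-- axiom IV: Lorentz boosts -/
  boost : ∀ (n : ℕ) (β : Fin n → ℂ) (θ : ℝ),
    AnalyticAt ℂ (F n) β → AnalyticAt ℂ (F n) (fun a => β a + θ) →
    F n (fun a => β a + θ) = Complex.exp (θ * s) * F n β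

/-- A form factor evaluated at a vector; the number of variables is the length of the vector. -/
def evalF (F : (n : ℕ) → (Fin n → ℂ) → ℂ) (L : List ℂ) : ℂ := F L.length L.get

/-! ### Variables, sets of variables and vectors -/

/-- Labels of the variables `α_a^{(p)}`, `0 ≤ p ≤ k`, `1 ≤ a ≤ r_p`. -/
abbrev Var (k : ℕ) (r : ℕ → ℕ) : Type := Σ p : Fin (k + 1), Fin (r p)

/-- Values of all the variables. -/
abbrev Config (k : ℕ) (r : ℕ → ℕ) : Type := Var k r → ℝ

variable {k : ℕ} {r : ℕ → ℕ}

/-- The set `A^{(p)}` of all variables of level `p`. -/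
def setA (p : ℕ) : Finset (Var k r) := Finset.univ.filter (fun v => (v.1 : ℕ) = p)

/-- All variables, listed by increasing level and index. -/
def allVars (k : ℕ) (r : ℕ → ℕ) : List (Var k r) :=
  (List.finRange (k + 1)).flatMap
    (fun p : Fin (k + 1) => (List.finRange (r p)).map (fun a => (⟨p, a⟩ : Var k r)))

/-- The index ordered vector built out of a set of variables (its reversal is the
left-arrow vector). -/
def vec (X : Finset (Var k r)) : List (Var k r) := (allVars k r).filter (fun v => v ∈ X)

/-- The vector `(ℓ_{σ(1)}, …, ℓ_{σ(n)})` built out of `L = (ℓ_1, …, ℓ_n)`. -/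
def permute {V : Type*} (L : List V) (σ : Equiv.Perm (Fin L.length)) : List V :=
  List.ofFn (fun a => L.get (σ a))

/-- The product of S-matrices `S(L ∣ L')` produced by reordering the vector `L` into `L'` through
exchanges of neighbours `(…, u, v, …) → (…, v, u, …)`, each giving a factor `S(u - v)`: one factor
for every pair `u, v` with `u` before `v` in `L` and `v` before `u` in `L'`. -/
def permS (b : ℝ) (x : Config k r) (L L' : List (Var k r)) : ℂ :=
  ∏ uv ∈ (Finset.univ : Finset (Var k r × Var k r)).filter
      (fun uv => List.Sublist [uv.1, uv.2] L ∧ List.Sublist [uv.2, uv.1] L'),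
    sMat b ((x uv.1 - x uv.2 : ℝ) : ℂ)

/-- The vector of real values of the coordinates of `L`. -/
def realArg (x : Config k r) (L : List (Var k r)) : List ℂ := L.map (fun v => (x v : ℂ))

/-- The vector `L + iπ e_ε`, with `e_ε = (1 - ε/π) (1, …, 1)`. -/
def shiftedArg (ε : ℝ) (x : Config k r) (L : List (Var k r)) : List ℂ :=
  L.map (fun v => (x v : ℂ) + Complex.I * Real.pi * (1 - ε / Real.pi))

/-! ### Generalised functions built from functions and Dirac masses -/

/-- Finite sums of products of functions of the variables and of Dirac masses: polynomials in the
symbols `δ_{u;v}` with functions as coefficients. -/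
abbrev GenFun (k : ℕ) (r : ℕ → ℕ) : Type := MvPolynomial (Var k r × Var k r) (Config k r → ℂ)

/-- A function of the variables as a generalised function. -/
def ofFun (h : Config k r → ℂ) : GenFun k r := MvPolynomial.C h

/-- `Δ(L ∣ L') = ∏_a 2π δ_{ℓ_a ; ℓ'_a}`, for vectors of equal length. -/
def Delta (L L' : List (Var k r)) : GenFun k r :=
  ((L.zip L').map (fun uv => ofFun (fun _ => 2 * Real.pi) * MvPolynomial.X uv)).prod

/-- The product of Dirac masses `∏_{(u,v) ∈ E} δ(x_u - x_v)`, as a measure: the variables tied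
together by `E` take a common value, and one integrates over these common values, one for each class
of tied variables, with the Lebesgue measure.  This is the usual product of Dirac masses whenever
the linear forms `x_u - x_v`, `(u,v) ∈ E`, are linearly independent, i.e. when the graph with edges
`E` is a forest; this holds for the products of interest, whose edges form, between any two
consecutive levels, a matching. -/
def diracMeasure (E : Finset (Var k r × Var k r)) : MeasureTheory.Measure (Config k r) :=
  letI : Fintype (Quot (fun u v => (u, v) ∈ E)) := Fintype.ofFinite _
  (MeasureTheory.volume : MeasureTheory.Measure (Quot (fun u v => (u, v) ∈ E) → ℝ)).map
    (fun y v => y (Quot.mk _ v))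

/-- The pairing of a generalised function with a test function. -/
def pair (T : GenFun k r) (φ : Config k r → ℂ) : ℂ :=
  ∑ E ∈ T.support, ∫ x, T.coeff E x * φ x ∂(diracMeasure E.support)

/-- All coefficients are locally integrable against the Dirac masses that they multiply, so that
`pair` defines a distribution. -/
def IsWellDefined (T : GenFun k r) : Prop :=
  ∀ E ∈ T.support, MeasureTheory.LocallyIntegrable (T.coeff E) (diracMeasure E.support)

/-! ### The kernels and their product -/

/-- The phase `exp(-2iπ ω_ℓ |A^{(ℓ-1)}|)`. -/
def phase (r : ℕ → ℕ) (ω : ℕ → ℝ) (l : ℕ) : ℂ :=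
  Complex.exp (-2 * Complex.I * Real.pi * ω l * r (l - 1))

/-- The regularised kernel `M^{(O_ℓ)}(A^{(ℓ-1)} ; A^{(ℓ)})_ε`, for `1 ≤ ℓ ≤ k`.  The sums run over
the partitions `A^{(ℓ-1)} = A₁ ∪ A₂` and `A^{(ℓ)} = B₁ ∪ B₂` with `|A₁| = |B₁|`, where the elements
of `B₁` are moreover labelled in an arbitrary order, specified by the permutation `σ`. -/
def kernel (b : ℝ) (ω : ℕ → ℝ) (F : ℕ → (n : ℕ) → (Fin n → ℂ) → ℂ) (ε : ℕ → ℝ) (l : ℕ) :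
    GenFun k r :=
  ofFun (fun _ => phase r ω l) *
  ∑ A₁ ∈ (setA (l - 1) : Finset (Var k r)).powerset,
    ∑ B₁ ∈ (setA l : Finset (Var k r)).powersetCard A₁.card,
      ∑ σ : Equiv.Perm (Fin (vec B₁).length),
        Delta (vec A₁) (permute (vec B₁) σ) *
        ofFun (fun x =>
          permS b x (vec (setA (l - 1))).reverse
            ((vec (setA (l - 1) \ A₁)).reverse ++ (vec A₁).reverse) *
          permS b x (vec (setA l)) (permute (vec B₁) σ ++ vec (setA l \ B₁)) *
          evalF (F l) (shiftedArg (ε l) x (vec (setA (l - 1) \ A₁)).reverse ++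
            realArg x (vec (setA l \ B₁))))

/-- Minkowski form of signature `(1, -1)`. -/
def mink (p y : ℝ × ℝ) : ℝ := p.1 * y.1 - p.2 * y.2

/-- Total relativistic momentum of particles of mass `m` with rapidities in `X`. -/
def momentum (m : ℝ) (x : Config k r) (X : Finset (Var k r)) : ℝ × ℝ :=
  ∑ v ∈ X, (m * Real.cosh (x v), m * Real.sinh (x v))

/-- The space-time point `y_s`, `1 ≤ s ≤ k`. -/
def pt (y : Fin k → ℝ × ℝ) (s : ℕ) : ℝ × ℝ := if h : s - 1 < k then y ⟨s - 1, h⟩ else 0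

/-- The phase `P({A^{(s)}}; {y_s})`. -/
def totalP (m : ℝ) (x : Config k r) (y : Fin k → ℝ × ℝ) : ℝ :=
  mink (momentum m x (setA 0)) (pt y 1) +
  ∑ p ∈ Finset.Icc 1 (k - 1), mink (momentum m x (setA p)) (pt y (p + 1) - pt y p) -
  mink (momentum m x (setA k)) (pt y k)

/-- The smeared Fourier factor `R[G]({A^{(s)}})`. -/
def totalR (m : ℝ) (G : 𝓢(Fin k → ℝ × ℝ, ℂ)) (x : Config k r) : ℂ :=
  ∫ y : Fin k → ℝ × ℝ, G y * Complex.exp (Complex.I * totalP m x y)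

/-- `G_tot[G]`: the product of the `k` regularised kernels and of the smeared Fourier factor. -/
def Gtot (b m : ℝ) (ω : ℕ → ℝ) (F : ℕ → (n : ℕ) → (Fin n → ℂ) → ℂ) (ε : ℕ → ℝ)
    (G : 𝓢(Fin k → ℝ × ℝ, ℂ)) : GenFun k r :=
  (∏ l ∈ Finset.Icc 1 k, kernel b ω F ε l) * ofFun (totalR m G)

/-! ### Refined partitions -/

/-- Data assigning to every variable the block to which it belongs. A variable `v` of level `p`
belongs to `A_s^{(p)}` if it is sent to `(s, false)` and to `γ^{(p+1 s)}` if it is sent to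
`(s, true)`. -/
abbrev Blocks (k : ℕ) (r : ℕ → ℕ) : Type := Var k r → Fin (k + 1) × Bool

/-- The block `A_s^{(p)}`. -/
def blockA (c : Blocks k r) (p s : ℕ) : Finset (Var k r) :=
  (setA p).filter (fun v => ((c v).1 : ℕ) = s ∧ (c v).2 = false)

/-- The block `γ^{(ua)}`, a subset of `A^{(u-1)}`. -/
def blockγ (c : Blocks k r) (u a : ℕ) : Finset (Var k r) :=
  (setA (u - 1)).filter (fun v => ((c v).1 : ℕ) = a ∧ (c v).2 = true)

/-- The block `B_s^{(k)}`, as a set. -/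
def blockB (c : Blocks k r) (s : ℕ) : Finset (Var k r) := blockA c k s

/-- The blocks are those of partitions `A^{(p)} = ⋃_{s ≤ p} A_s^{(p)} ∪ ⋃_{s ≤ p} γ^{(p+1 s)}`,
`1 ≤ p ≤ k-1`, and `A^{(k)} = ⋃_{s ≤ k} B_s^{(k)}`, subject to the constraints on cardinalities. -/
structure IsRefined (c : Blocks k r) : Prop where
  index : ∀ v, 1 ≤ ((c v).1 : ℕ) ∧ ((c v).1 : ℕ) ≤ v.1
  last : ∀ v ∈ setA k, (c v).2 = false
  card_inner : ∀ p s : ℕ, 2 ≤ p → p ≤ k - 1 → 1 ≤ s → s ≤ p - 1 →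
    (blockA c (p - 1) s).card = (blockA c p s ∪ blockγ c (p + 1) s).card
  card_outer : ∀ s : ℕ, 1 ≤ s → s ≤ k - 1 → (blockA c (k - 1) s).card = (blockB c s).card

/-- Pairs `(p, s)` with `2 ≤ p ≤ k-1` and `1 ≤ s ≤ p-1`. -/
abbrev InnerIdx (k : ℕ) : Type := {ps : Fin k × Fin k // 1 ≤ (ps.2 : ℕ) ∧ (ps.2 : ℕ) < ps.1}

/-- Integers `s` with `1 ≤ s ≤ k-1`. -/
abbrev OuterIdx (k : ℕ) : Type := {s : Fin k // 1 ≤ (s : ℕ)}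

/-- The permutations `σ_s^{(p-1)}` of `|A_s^{(p)} ∪ γ^{(p+1 s)}| = |A_s^{(p-1)}|` objects. -/
abbrev InnerPerms (c : Blocks k r) : Type :=
  (i : InnerIdx k) →
    Equiv.Perm (Fin (vec (blockA c (i.1.1 : ℕ) i.1.2 ∪ blockγ c ((i.1.1 : ℕ) + 1) i.1.2)).length)

/-- The orders in which the elements of `B_1^{(k)}, …, B_{k-1}^{(k)}` are labelled. -/
abbrev OuterPerms (c : Blocks k r) : Type :=
  (i : OuterIdx k) → Equiv.Perm (Fin (vec (blockB c i.1)).length)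

/-- The vector attached to `γ^{(ua)}`. -/
def vecγ (c : Blocks k r) (u a : ℕ) : List (Var k r) := vec (blockγ c u a)

/-- The vector attached to `B_s^{(k)}`: arbitrarily ordered for `s ≤ k-1`, index ordered for
`s = k`. -/
def vecB (c : Blocks k r) (τ : OuterPerms c) (s : ℕ) : List (Var k r) :=
  if h : 1 ≤ s ∧ s < k then permute (vec (blockB c s)) (τ ⟨⟨s, h.2⟩, h.1⟩) else vec (blockB c s)

/-- The product of S-matrices `𝒮({B_s^{(k)} ; γ^{(ua)}})`. -/
def refinedS (b : ℝ) (c : Blocks k r) (τ : OuterPerms c) (x : Config k r) : ℂ :=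
  permS b x (vec (setA k)) ((List.range k).flatMap (fun s => vecB c τ (s + 1))) *
  (∏ p ∈ Finset.Icc 2 (k - 1), ∏ s ∈ Finset.Icc 1 (p - 1), ∏ v ∈ Finset.Icc (s + 1) p,
    permS b x (vecB c τ v ++ vecγ c (p + 1) s) (vecγ c (p + 1) s ++ vecB c τ v)) *
  ∏ p ∈ Finset.Icc 3 k, ∏ v ∈ Finset.Icc (p + 1) k,
    ∏ u ∈ Finset.Icc 1 (p - 1), ∏ s ∈ Finset.Icc 1 (u - 1),
      permS b x (vecγ c v u ++ vecγ c p s) (vecγ c p s ++ vecγ c v u)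

/-- The vector `γ^{(p p-1)} ∪ … ∪ γ^{(p 1)}`, each of the blocks being reversed. -/
def leftArg (c : Blocks k r) (p : ℕ) : List (Var k r) :=
  (List.range (p - 1)).reverse.flatMap (fun j => (vecγ c p (j + 1)).reverse)

/-- The vector `B_p^{(k)} ∪ γ^{(kp)} ∪ … ∪ γ^{(p+1 p)}`. -/
def rightArg (c : Blocks k r) (τ : OuterPerms c) (p : ℕ) : List (Var k r) :=
  vecB c τ p ++ (List.range (k - p)).reverse.flatMap (fun j => vecγ c (p + 1 + j) p)

/-- The product of form factors. -/
def refinedF (F : ℕ → (n : ℕ) → (Fin n → ℂ) → ℂ) (ε : ℕ → ℝ) (c : Blocks k r)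
    (τ : OuterPerms c) (x : Config k r) : ℂ :=
  ∏ p ∈ Finset.Icc 1 k,
    evalF (F p) (shiftedArg (ε p) x (leftArg c p) ++ realArg x (rightArg c τ p))

/-- The phase `𝒫({B_s^{(k)}}; {γ^{(us)}}; {y_s})`. -/
def refinedP (m : ℝ) (c : Blocks k r) (x : Config k r) (y : Fin k → ℝ × ℝ) : ℝ :=
  ∑ u ∈ Finset.Icc 1 k, ∑ s ∈ Finset.Icc 1 (u - 1),
    mink (momentum m x (blockγ c u s)) (pt y u - pt y s) -
  ∑ s ∈ Finset.Icc 1 k, mink (momentum m x (blockB c s)) (pt y s)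

/-- The smeared Fourier factor `ℛ[G]({B_s^{(k)}}; {γ^{(us)}})`. -/
def refinedR (m : ℝ) (G : 𝓢(Fin k → ℝ × ℝ, ℂ)) (c : Blocks k r) (x : Config k r) : ℂ :=
  ∫ y : Fin k → ℝ × ℝ, G y * Complex.exp (Complex.I * refinedP m c x y)

open Classical in
/-- The sum over refined partitions and permutations. -/
def refinedSum (b m : ℝ) (ω : ℕ → ℝ) (F : ℕ → (n : ℕ) → (Fin n → ℂ) → ℂ) (ε : ℕ → ℝ)
    (G : 𝓢(Fin k → ℝ × ℝ, ℂ)) : GenFun k r :=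
  ofFun (fun _ => ∏ s ∈ Finset.Icc 1 k, phase r ω s) *
  ∑ c ∈ (Finset.univ : Finset (Blocks k r)).filter IsRefined,
    ∑ σ : InnerPerms c, ∑ τ : OuterPerms c,
      ofFun (refinedS b c τ) *
      (∏ i : InnerIdx k, Delta (vec (blockA c ((i.1.1 : ℕ) - 1) i.1.2))
        (permute (vec (blockA c (i.1.1 : ℕ) i.1.2 ∪ blockγ c ((i.1.1 : ℕ) + 1) i.1.2)) (σ i))) *
      (∏ i : OuterIdx k, Delta (vec (blockA c (k - 1) i.1)) (vecB c τ i.1)) *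
      ofFun (refinedF F ε c τ) *
      ofFun (refinedR m G c)

end

end ShG

/-!
Both sides are sums over the same index set: families of matchings between consecutive levels of
variables, encoded as maps `f` that send a variable to the one it is tied to at the next level
(`IsLink`). In the product of kernels, a partition of two consecutive levels together with a
labelling is exactly one matching (`sum_partitions_eq_sum_localLinks`), and the matchings of the
different levels are independent (`prod_sum_localLinks`). On the other side, following the ties of
`f` splits the variables into chains; recording the level at which the chain of each variable starts
and whether the chain ends there is the refined partition (`IsCompatible`), and the permutations
recover the ties between the blocks (`IsRefined.isLink_linkOf`, `IsCompatible.exists_linkOf_eq`).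

A product of Dirac masses only sees its coefficient where tied variables coincide, so it suffices to
compare the coefficients of each `f` there, without any integration (`pair_eq_of_restrict_eq`). All
variables of a chain may then be replaced by the last one, and three things remain.

* Phases: along a chain from level `s` to level `p` the differences `y_{q+1} - y_q` telescope
  (`IsCompatible.totalP_eq_refinedP`).
* Form factors: the exchange axiom reorders the arguments, at the price of S-matrices
  (`IsFormFactor.evalF_reorder`). The shifts `0 < ε < π` keep all arguments away from the poles;
  this also makes the coefficients continuous, hence both sides well defined.
* S-matrices: the products `permS` compose, `S(X|Y) S(Y|Z) = S(X|Z)`, by unitarity (`permS_trans`).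
  Compare, at each level, the actual order of the chains with the reference order by starting level
  and then by decreasing end level. The comparisons at consecutive levels cancel
  (`kernelCoeff_eq`), up to the one at level `k`, and up to the exchanges that move the chains that
  end at some level behind those that continue. The latter are the products of S-matrices between
  pairs of blocks (`prod_permS_contOrd_append_endOrd`).
-/

namespace ShG

/-! ### Ordered pairs of entries of a list -/

section Pairs

variable {α β : Type*} {u v : α} {L L₁ L₂ : List α}

theorem mem_of_pair_sublist (h : List.Sublist [u, v] L) : u ∈ L ∧ v ∈ L :=
  ⟨h.subset (by simp), h.subset (by simp)⟩

theorem pair_sublist_append :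
    List.Sublist [u, v] (L₁ ++ L₂) ↔
      List.Sublist [u, v] L₁ ∨ (u ∈ L₁ ∧ v ∈ L₂) ∨ List.Sublist [u, v] L₂ := by
  rw [List.sublist_append_iff]
  constructor
  · rintro ⟨l₁, l₂, h, h₁, h₂⟩
    rcases l₁ with _ | ⟨a, _ | ⟨c, l⟩⟩
    · simp at h; subst h; exact Or.inr (Or.inr h₂)
    · simp at h; obtain ⟨rfl, rfl⟩ := h
      exact Or.inr (Or.inl ⟨h₁.subset (by simp), h₂.subset (by simp)⟩)
    · simp at h; obtain ⟨rfl, rfl, rfl, rfl⟩ := h; exact Or.inl h₁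
  · rintro (h | ⟨h₁, h₂⟩ | h)
    · exact ⟨[u, v], [], by simp, h, List.nil_sublist _⟩
    · exact ⟨[u], [v], rfl, List.singleton_sublist.2 h₁, List.singleton_sublist.2 h₂⟩
    · exact ⟨[], [u, v], rfl, List.nil_sublist _, h⟩

theorem pair_sublist_reverse : List.Sublist [u, v] L.reverse ↔ List.Sublist [v, u] L := by
  rw [← List.reverse_sublist]; simp

theorem pair_sublist_cons {a : α} :
    List.Sublist [u, v] (a :: L) ↔ (u = a ∧ v ∈ L) ∨ List.Sublist [u, v] L := by
  have := @pair_sublist_append α u v [a] L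
  simp only [List.singleton_append, List.mem_singleton] at this
  rw [this]
  constructor
  · rintro (h | h | h)
    · have := h.length_le; simp at this
    · exact Or.inl h
    · exact Or.inr h
  · rintro (h | h)
    · exact Or.inr (Or.inl h)
    · exact Or.inr (Or.inr h)

theorem pair_sublist_map {g : β → α} {M : List β} :
    List.Sublist [u, v] (M.map g) ↔ ∃ a c, List.Sublist [a, c] M ∧ g a = u ∧ g c = v := by
  rw [List.sublist_map_iff]
  constructor
  · rintro ⟨l, hl, h⟩
    rcases l with _ | ⟨a, _ | ⟨c, _ | ⟨d, l⟩⟩⟩ <;> simp at h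
    exact ⟨a, c, hl, h.1.symm, h.2.symm⟩
  · rintro ⟨a, c, h, rfl, rfl⟩
    exact ⟨[a, c], h, rfl⟩

theorem pair_sublist_asymm (hL : L.Nodup) (h : List.Sublist [u, v] L) :
    ¬ List.Sublist [v, u] L := by
  induction L with
  | nil => simp at h
  | cons a L ih =>
    rw [List.nodup_cons] at hL
    rw [pair_sublist_cons] at h ⊢
    rintro (⟨rfl, h₂⟩ | h₂)
    · rcases h with ⟨rfl, h⟩ | h
      · exact hL.1 h
      · exact hL.1 (mem_of_pair_sublist h).2
    · rcases h with ⟨rfl, h⟩ | h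
      · exact hL.1 (mem_of_pair_sublist h₂).2
      · exact ih hL.2 h h₂

theorem pair_sublist_total (hu : u ∈ L) (hv : v ∈ L) (huv : u ≠ v) :
    List.Sublist [u, v] L ∨ List.Sublist [v, u] L := by
  induction L with
  | nil => simp at hu
  | cons a L ih =>
    rw [pair_sublist_cons, pair_sublist_cons]
    rw [List.mem_cons] at hu hv
    rcases hu with rfl | hu <;> rcases hv with rfl | hv
    · exact absurd rfl huv
    · exact Or.inl (Or.inl ⟨rfl, hv⟩)
    · exact Or.inr (Or.inl ⟨rfl, hu⟩)
    · rcases ih hu hv with h | h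
      · exact Or.inl (Or.inr h)
      · exact Or.inr (Or.inr h)

end Pairs

/-! ### Vectors and their reorderings -/

section Vectors

variable {k : ℕ} {r : ℕ → ℕ}

theorem mem_allVars (v : Var k r) : v ∈ allVars k r := by
  rcases v with ⟨p, a⟩
  simp [allVars]

theorem nodup_allVars : (allVars k r).Nodup := by
  rw [allVars, List.nodup_flatMap]
  refine ⟨fun p _ => (List.nodup_finRange _).map (fun a c h => by simpa using h), ?_⟩
  refine (List.nodup_finRange (k + 1)).imp ?_
  intro p q hpq v hv hv'
  simp only [List.mem_map] at hv hv'
  obtain ⟨a, -, rfl⟩ := hv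
  obtain ⟨c, -, h⟩ := hv'
  exact hpq (congrArg Sigma.fst h).symm

theorem mem_vec {X : Finset (Var k r)} {v : Var k r} : v ∈ vec X ↔ v ∈ X := by
  simp [vec, mem_allVars]

theorem nodup_vec (X : Finset (Var k r)) : (vec X).Nodup := nodup_allVars.filter _

theorem toFinset_vec (X : Finset (Var k r)) : (vec X).toFinset = X := by
  ext v; simp [mem_vec]

theorem length_vec (X : Finset (Var k r)) : (vec X).length = X.card := by
  rw [← List.toFinset_card_of_nodup (nodup_vec X), toFinset_vec]

theorem vec_empty : vec (∅ : Finset (Var k r)) = [] := by simp [vec]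

/-- Two lists without repetition are reorderings of one another as soon as they have the same
entries. -/
theorem perm_of_mem_iff {α : Type*} {L L' : List α} (h : L.Nodup) (h' : L'.Nodup)
    (hm : ∀ v, v ∈ L ↔ v ∈ L') : L.Perm L' := by
  classical
  exact (List.perm_ext_iff_of_nodup h h').2 hm

theorem permute_perm {α : Type*} (L : List α) (σ : Equiv.Perm (Fin L.length)) :
    (permute L σ).Perm L := by
  have := σ.ofFn_comp_perm L.get
  rw [List.ofFn_get] at this
  exact this

theorem permute_injective {α : Type*} {L : List α} (hL : L.Nodup) :
    Function.Injective (permute L) := by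
  intro σ τ h
  ext a
  have h₂ := congrFun (List.ofFn_injective h) a
  exact congrArg Fin.val (List.nodup_iff_injective_get.1 hL h₂)

theorem exists_permute_eq {α : Type*} {L L' : List α} (hL : L.Nodup) (h : L'.Perm L) :
    ∃ σ, permute L σ = L' := by
  classical
  have hlen := h.length_eq
  have hL' := h.nodup_iff.2 hL
  let g : Fin L.length → Fin L.length := fun a =>
    ⟨L.idxOf (L'.get (a.cast hlen.symm)), List.idxOf_lt_length_iff.2 (h.subset (List.get_mem _ _))⟩
  have hg : ∀ a, L.get (g a) = L'.get (a.cast hlen.symm) := fun a => by simp [g]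
  have hinj : Function.Injective g := by
    intro a c hac
    have := (hg a).symm.trans ((congrArg L.get hac).trans (hg c))
    have := List.nodup_iff_injective_get.1 hL' this
    simpa using this
  refine ⟨Equiv.ofBijective g (Finite.injective_iff_bijective.1 hinj), ?_⟩
  refine List.ext_get (by simp [permute, hlen]) ?_
  intro n h₁ h₂
  have := hg ⟨n, hlen ▸ h₂⟩
  simpa [permute] using this

end Vectors

/-! ### The S-matrix and products of S-matrices -/

section PermS

variable {k : ℕ} {r : ℕ → ℕ}

theorem sMat_denom_ne_zero {b : ℝ} (h : Real.sin (2 * Real.pi * b) ≠ 0) (t : ℝ) :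
    Complex.sinh t + Complex.I * Real.sin (2 * Real.pi * b) ≠ 0 := by
  intro h₀
  apply h
  have := congrArg Complex.im h₀
  simpa [← Complex.ofReal_sinh, -Complex.ofReal_sin] using this

theorem sMat_mul_neg (b t : ℝ) : sMat b t * sMat b (-t : ℝ) = 1 := by
  unfold sMat
  split_ifs with h
  · simp
  · have h₁ := sMat_denom_ne_zero h t
    have h₂ := sMat_denom_ne_zero h (-t)
    rw [div_mul_div_comm, div_eq_one_iff_eq (mul_ne_zero h₁ h₂)]
    rw [Complex.ofReal_neg, Complex.sinh_neg]
    ring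

theorem sMat_ne_zero (b t : ℝ) : sMat b t ≠ 0 := left_ne_zero_of_mul_eq_one (sMat_mul_neg b t)

/-- The factor `S(u - v)` of an ordered pair of variables. -/
noncomputable def pairS (b : ℝ) (x : Config k r) (u v : Var k r) : ℂ := sMat b ((x u - x v : ℝ) : ℂ)

theorem pairS_mul_swap (b : ℝ) (x : Config k r) (u v : Var k r) :
    pairS b x u v * pairS b x v u = 1 := by
  have := sMat_mul_neg b (x u - x v)
  rwa [neg_sub] at this

theorem pairS_ne_zero (b : ℝ) (x : Config k r) (u v : Var k r) : pairS b x u v ≠ 0 :=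
  sMat_ne_zero _ _

variable {b : ℝ} {x : Config k r} {L L' L'' L₁ L₂ L₁' L₂' : List (Var k r)}

theorem permS_eq_prod_ite (L L' : List (Var k r)) :
    permS b x L L' = ∏ uv : Var k r × Var k r,
      if List.Sublist [uv.1, uv.2] L ∧ List.Sublist [uv.2, uv.1] L' then pairS b x uv.1 uv.2
      else 1 := by
  rw [permS, Finset.prod_filter]
  rfl

theorem permS_self (hL : L.Nodup) : permS b x L L = 1 := by
  rw [permS_eq_prod_ite]
  refine Finset.prod_eq_one fun uv _ => if_neg ?_
  rintro ⟨h₁, h₂⟩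
  exact pair_sublist_asymm hL h₁ h₂

theorem permS_nil : permS b x [] [] = 1 := permS_self List.nodup_nil

theorem permS_reverse (L L' : List (Var k r)) :
    permS b x L.reverse L'.reverse = permS b x L' L := by
  rw [permS_eq_prod_ite, permS_eq_prod_ite]
  refine Finset.prod_congr rfl fun uv _ => ?_
  simp only [pair_sublist_reverse, and_comm]

/-- The products of S-matrices compose: this is where unitarity `S(β) S(-β) = 1` enters, the pairs
that are exchanged twice giving no factor. -/
theorem permS_trans (hL : L.Nodup) (h : L.Perm L') (h' : L'.Perm L'') :
    permS b x L L' * permS b x L' L'' = permS b x L L'' := by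
  have hL' := h.nodup_iff.1 hL
  have hL'' := h'.nodup_iff.1 hL'
  rw [permS_eq_prod_ite, permS_eq_prod_ite, permS_eq_prod_ite, ← Finset.prod_mul_distrib]
  set f : Var k r × Var k r → ℂ := fun uv =>
    (if List.Sublist [uv.1, uv.2] L ∧ List.Sublist [uv.2, uv.1] L' then pairS b x uv.1 uv.2
      else 1) *
    (if List.Sublist [uv.1, uv.2] L' ∧ List.Sublist [uv.2, uv.1] L'' then pairS b x uv.1 uv.2
      else 1)
  set g : Var k r × Var k r → ℂ := fun uv =>
    if List.Sublist [uv.1, uv.2] L ∧ List.Sublist [uv.2, uv.1] L'' then pairS b x uv.1 uv.2 else 1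
  have hg : ∀ uv, g uv ≠ 0 := by
    intro uv
    simp only [g]
    split_ifs
    · exact pairS_ne_zero _ _ _ _
    · exact one_ne_zero
  suffices hfg : ∏ uv, f uv / g uv = 1 by
    rw [Finset.prod_div_distrib, div_eq_one_iff_eq (Finset.prod_ne_zero_iff.2 fun uv _ => hg uv)]
      at hfg
    exact hfg
  have irrefl : ∀ {M : List (Var k r)}, M.Nodup → ∀ u, ¬ List.Sublist [u, u] M :=
    fun hM u hu => pair_sublist_asymm hM hu hu
  refine Finset.prod_involution (fun uv _ => uv.swap) ?_ ?_ (fun _ _ => Finset.mem_univ _)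
    (fun _ _ => Prod.swap_swap _)
  · rintro ⟨u, v⟩ -
    rw [div_mul_div_comm, div_eq_one_iff_eq (mul_ne_zero (hg _) (hg _))]
    have hS := pairS_mul_swap b x u v
    by_cases huv : u = v
    · subst huv
      simp [f, g, irrefl hL, irrefl hL']
    by_cases hu : u ∈ L ∧ v ∈ L
    · have hu' : u ∈ L' ∧ v ∈ L' := ⟨h.subset hu.1, h.subset hu.2⟩
      have hu'' : u ∈ L'' ∧ v ∈ L'' := ⟨h'.subset hu'.1, h'.subset hu'.2⟩
      have key : ∀ {M : List (Var k r)}, M.Nodup → u ∈ M ∧ v ∈ M →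
          (List.Sublist [v, u] M ↔ ¬ List.Sublist [u, v] M) := fun hM hm =>
        ⟨fun h₁ h₂ => pair_sublist_asymm hM h₁ h₂,
          fun h₁ => (pair_sublist_total hm.1 hm.2 huv).resolve_left h₁⟩
      simp only [f, g, Prod.swap_prod_mk, key hL hu, key hL' hu', key hL'' hu'']
      by_cases h₁ : List.Sublist [u, v] L <;> by_cases h₂ : List.Sublist [u, v] L' <;>
        by_cases h₃ : List.Sublist [u, v] L'' <;> simp [h₁, h₂, h₃, hS, mul_comm _ (pairS b x u v)]
    · have n₁ : ∀ {M : List (Var k r)}, (∀ w, w ∈ M → w ∈ L) → ¬ List.Sublist [u, v] M :=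
        fun hM h₁ => hu ⟨hM _ (mem_of_pair_sublist h₁).1, hM _ (mem_of_pair_sublist h₁).2⟩
      have n₂ : ∀ {M : List (Var k r)}, (∀ w, w ∈ M → w ∈ L) → ¬ List.Sublist [v, u] M :=
        fun hM h₁ => hu ⟨hM _ (mem_of_pair_sublist h₁).2, hM _ (mem_of_pair_sublist h₁).1⟩
      have e₁ : ∀ w, w ∈ L' → w ∈ L := fun w hw => h.symm.subset hw
      simp [f, g, n₁ (M := L) (fun _ => id), n₂ (M := L) (fun _ => id), n₁ e₁, n₂ e₁]
  · rintro ⟨u, v⟩ - hne heq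
    obtain rfl : v = u := congrArg Prod.fst heq
    apply hne
    simp [f, g, irrefl hL, irrefl hL']

theorem permS_mul_symm (hL : L.Nodup) (h : L.Perm L') :
    permS b x L L' * permS b x L' L = 1 := by
  rw [permS_trans hL h h.symm, permS_self hL]

theorem permS_append (hL : (L₁ ++ L₂).Nodup) (h₁ : L₁.Perm L₁') (h₂ : L₂.Perm L₂') :
    permS b x (L₁ ++ L₂) (L₁' ++ L₂') = permS b x L₁ L₁' * permS b x L₂ L₂' := by
  have hd := List.disjoint_of_nodup_append hL
  rw [permS_eq_prod_ite, permS_eq_prod_ite, permS_eq_prod_ite, ← Finset.prod_mul_distrib]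
  refine Finset.prod_congr rfl ?_
  rintro ⟨u, v⟩ -
  simp only [pair_sublist_append, ← h₁.mem_iff, ← h₂.mem_iff]
  have a₁ : List.Sublist [u, v] L₁ → u ∈ L₁ ∧ v ∈ L₁ := mem_of_pair_sublist
  have a₂ : List.Sublist [u, v] L₂ → u ∈ L₂ ∧ v ∈ L₂ := mem_of_pair_sublist
  have a₃ : List.Sublist [v, u] L₁' → u ∈ L₁ ∧ v ∈ L₁ := fun h =>
    ⟨h₁.mem_iff.2 (mem_of_pair_sublist h).2, h₁.mem_iff.2 (mem_of_pair_sublist h).1⟩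
  have a₄ : List.Sublist [v, u] L₂' → u ∈ L₂ ∧ v ∈ L₂ := fun h =>
    ⟨h₂.mem_iff.2 (mem_of_pair_sublist h).2, h₂.mem_iff.2 (mem_of_pair_sublist h).1⟩
  have d₁ : u ∈ L₁ → u ∉ L₂ := fun h h' => hd h h'
  have d₂ : v ∈ L₁ → v ∉ L₂ := fun h h' => hd h h'
  by_cases c₁ : List.Sublist [u, v] L₁ <;> by_cases c₂ : List.Sublist [u, v] L₂ <;>
    by_cases c₃ : List.Sublist [v, u] L₁' <;> by_cases c₄ : List.Sublist [v, u] L₂' <;>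
    simp only [c₁, c₂, c₃, c₄, true_or, or_true, and_true, true_and, false_or, or_false,
      and_false, if_true, if_false, mul_one, one_mul] <;>
    simp only [c₁, c₂, c₃, c₄, forall_const, false_imp_iff] at a₁ a₂ a₃ a₄ <;>
    first
    | rfl
    | (exfalso; tauto)
    | (rw [if_neg]; tauto)

theorem permS_append_left (hL : (L ++ L₁).Nodup) (h : L₁.Perm L₁') :
    permS b x (L ++ L₁) (L ++ L₁') = permS b x L₁ L₁' := by
  rw [permS_append hL (List.Perm.refl _) h, permS_self (List.Nodup.of_append_left hL), one_mul]

theorem permS_append_right (hL : (L₁ ++ L).Nodup) (h : L₁.Perm L₁') :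
    permS b x (L₁ ++ L) (L₁' ++ L) = permS b x L₁ L₁' := by
  rw [permS_append hL h (List.Perm.refl _), permS_self (List.Nodup.of_append_right hL), mul_one]

/-- Relabelling the variables without changing their values. -/
theorem permS_map {g : Var k r → Var k r} (hx : ∀ v, x (g v) = x v)
    (hg : ∀ u ∈ L, ∀ v ∈ L, g u = g v → u = v) (h : L.Perm L') :
    permS b x (L.map g) (L'.map g) = permS b x L L' := by
  symm
  unfold permS
  refine Finset.prod_bij (fun uv _ => (g uv.1, g uv.2)) ?_ ?_ ?_ ?_
  · rintro ⟨u, v⟩ huv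
    simp only [Finset.mem_filter, Finset.mem_univ, true_and] at huv ⊢
    exact ⟨huv.1.map g, huv.2.map g⟩
  · rintro ⟨u, v⟩ huv ⟨u', v'⟩ huv' heq
    simp only [Finset.mem_filter, Finset.mem_univ, true_and, Prod.mk.injEq] at huv huv' heq ⊢
    have m := mem_of_pair_sublist huv.1
    have m' := mem_of_pair_sublist huv'.1
    exact ⟨hg _ m.1 _ m'.1 heq.1, hg _ m.2 _ m'.2 heq.2⟩
  · rintro ⟨u, v⟩ huv
    simp only [Finset.mem_filter, Finset.mem_univ, true_and, pair_sublist_map] at huv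
    obtain ⟨⟨a, c, h₁, rfl, rfl⟩, ⟨c', a', h₂, e₁, e₂⟩⟩ := huv
    have m := mem_of_pair_sublist h₁
    have m' := mem_of_pair_sublist h₂
    obtain rfl := hg _ (h.mem_iff.2 m'.1) _ m.2 e₁
    obtain rfl := hg _ (h.mem_iff.2 m'.2) _ m.1 e₂
    exact ⟨(a', c'), by simp [h₁, h₂], rfl⟩
  · rintro ⟨u, v⟩ -
    simp [hx]

/-- The product of `S(u - v)` over the entries `u` of `L` and `v` of `M`. -/
noncomputable def crossS (b : ℝ) (x : Config k r) (L M : List (Var k r)) : ℂ :=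
  (L.map fun u => (M.map fun v => pairS b x u v).prod).prod

theorem crossS_append_left (L₁ L₂ M : List (Var k r)) :
    crossS b x (L₁ ++ L₂) M = crossS b x L₁ M * crossS b x L₂ M := by
  simp [crossS]

theorem crossS_append_right (L M₁ M₂ : List (Var k r)) :
    crossS b x L (M₁ ++ M₂) = crossS b x L M₁ * crossS b x L M₂ := by
  simp [crossS, List.prod_map_mul]

theorem crossS_nil_left (M : List (Var k r)) : crossS b x [] M = 1 := by simp [crossS]

theorem crossS_nil_right (M : List (Var k r)) : crossS b x M [] = 1 := by simp [crossS]

theorem permS_append_comm (h : (L ++ L').Nodup) :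
    permS b x (L ++ L') (L' ++ L) = crossS b x L L' := by
  have hd := List.disjoint_of_nodup_append h
  have hL := List.Nodup.of_append_left h
  have hL' := List.Nodup.of_append_right h
  have e : crossS b x L L' = ∏ uv ∈ L.toFinset ×ˢ L'.toFinset, pairS b x uv.1 uv.2 := by
    rw [Finset.prod_product, crossS, ← List.prod_toFinset _ hL]
    exact Finset.prod_congr rfl fun u _ => (List.prod_toFinset _ hL').symm
  rw [e, permS]
  refine Finset.prod_congr ?_ fun _ _ => rfl
  ext ⟨u, v⟩
  simp only [Finset.mem_filter, Finset.mem_univ, true_and, pair_sublist_append,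
    Finset.mem_product, List.mem_toFinset]
  have d₁ : ∀ w, w ∈ L → w ∉ L' := fun w h h' => hd h h'
  constructor
  · rintro ⟨h₁ | h₁ | h₁, h₂ | h₂ | h₂⟩
    · exact absurd (mem_of_pair_sublist h₂).1 (d₁ _ (mem_of_pair_sublist h₁).2)
    · exact absurd h₂.1 (d₁ _ (mem_of_pair_sublist h₁).2)
    · exact absurd h₂ (pair_sublist_asymm hL h₁)
    all_goals first | exact h₁ | skip
    · exact absurd h₂ (pair_sublist_asymm hL' h₁)
    · exact absurd (mem_of_pair_sublist h₁).1 (d₁ _ h₂.2)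
    · exact absurd (mem_of_pair_sublist h₁).1 (d₁ _ (mem_of_pair_sublist h₂).2)
  · rintro ⟨h₁, h₂⟩
    exact ⟨Or.inr (Or.inl ⟨h₁, h₂⟩), Or.inr (Or.inl ⟨h₂, h₁⟩)⟩

end PermS

/-! ### Reordering the arguments of a form factor -/

section Exchange

variable {k : ℕ} {r : ℕ → ℕ}

/-- A function of vectors which picks up a factor `S(u - v)` under each exchange of neighbours picks
up `permS` under a general reordering. -/
theorem eq_permS_mul_of_exchange {b : ℝ} {x : Config k r} {φ : List (Var k r) → ℂ}
    (hφ : ∀ P u v Q, φ (P ++ u :: v :: Q) = pairS b x u v * φ (P ++ v :: u :: Q))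
    {X X' : List (Var k r)} (hX : X.Nodup) (h : X.Perm X') :
    φ X = permS b x X X' * φ X' := by
  suffices H : ∀ P, φ (P ++ X) = permS b x X X' * φ (P ++ X') from H []
  induction h with
  | nil => intro P; rw [permS_nil, one_mul]
  | @cons a X X' h ih =>
    intro P
    have := ih (List.nodup_cons.1 hX).2 (P ++ [a])
    simp only [List.append_assoc, List.singleton_append] at this
    rw [this, ← permS_append_left (L := [a]) (by simpa using hX) h]
    rfl
  | swap u v X =>
    intro P
    have hvu : ([v] ++ [u]).Nodup := List.Nodup.of_append_left (l₂ := X) (by simpa using hX)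
    have hs : permS b x ([v] ++ [u] ++ X) ([u] ++ [v] ++ X) = pairS b x v u := by
      rw [permS_append_right (L₁ := [v] ++ [u]) (L₁' := [u] ++ [v]) (by simpa using hX)
        (List.Perm.swap _ _ _), permS_append_comm hvu]
      simp [crossS]
    rw [hφ, ← hs]
    rfl
  | trans h h' ih ih' =>
    intro P
    rw [ih hX, ih' (h.nodup_iff.1 hX), ← permS_trans hX h h', mul_assoc]

theorem evalF_eq (F : (n : ℕ) → (Fin n → ℂ) → ℂ) (L : List ℂ) {n : ℕ} (h : n = L.length) :
    evalF F L = F n (fun i => L.get (i.cast h)) := by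
  subst h; rfl

/-- The vectors of rapidities with decreasing imaginary parts that avoid the poles. -/
def IsRegularArg (L : List ℂ) : Prop :=
  L.Pairwise fun a c => 0 ≤ (a - c).im ∧ (a - c).im < 2 * Real.pi ∧ a - c ≠ Real.pi * Complex.I

variable {b ω w : ℝ} {s : ℂ} {F : (n : ℕ) → (Fin n → ℂ) → ℂ}

theorem IsFormFactor.analyticAt (hF : IsFormFactor b ω s w F) {L : List ℂ} (hL : IsRegularArg L)
    {n : ℕ} (h : n = L.length) : AnalyticAt ℂ (F n) (fun i => L.get (i.cast h)) := by
  subst h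
  rw [IsRegularArg, List.pairwise_iff_get] at hL
  exact hF.regular _ _ (fun a c hac => ⟨(hL a c hac).1, (hL a c hac).2.1⟩)
    (fun a c hac => (hL a c hac).2.2)

theorem IsFormFactor.evalF_exchange (hF : IsFormFactor b ω s w F) {P Q : List ℂ} {a c : ℂ}
    (h : IsRegularArg (P ++ a :: c :: Q)) (h' : IsRegularArg (P ++ c :: a :: Q)) {t : ℝ}
    (ht : a - c = t) :
    evalF F (P ++ a :: c :: Q) = sMat b t * evalF F (P ++ c :: a :: Q) := by
  by_cases h₀ : Complex.sinh t + Complex.I * Real.sin (2 * Real.pi * b) = 0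
  · -- The exchange relation is void here: this is the free theory at coinciding rapidities.
    have hs : Real.sin (2 * Real.pi * b) = 0 := by
      by_contra hs
      exact sMat_denom_ne_zero hs t h₀
    rw [hs] at h₀
    have ht₀ : t = 0 := by
      rw [← Real.sinh_eq_zero]
      have : ((Real.sinh t : ℝ) : ℂ) = 0 := by simpa using h₀
      exact_mod_cast this
    have hac : a = c := by rw [ht₀] at ht; exact sub_eq_zero.1 (by simpa using ht)
    subst hac
    rw [sMat, if_pos hs, one_mul]
  have hn : (P ++ a :: c :: Q).length = (P ++ a :: c :: Q).length := rfl
  have hn' : (P ++ a :: c :: Q).length = (P ++ c :: a :: Q).length := by simp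
  rw [evalF_eq F _ hn, evalF_eq F _ hn']
  have hi : P.length < (P ++ a :: c :: Q).length := by simp
  have hj : P.length + 1 < (P ++ a :: c :: Q).length := by simp
  have hswap : (fun i : Fin (P ++ a :: c :: Q).length =>
        (P ++ a :: c :: Q).get (i.cast hn)) ∘ Equiv.swap ⟨P.length, hi⟩ ⟨P.length + 1, hj⟩ =
      fun i => (P ++ c :: a :: Q).get (i.cast hn') := by
    funext i
    rw [Function.comp_apply, Equiv.swap_apply_def]
    split_ifs with h₁ h₂
    · subst h₁; simp
    · subst h₂; simp
    · have h₁ : (i : ℕ) ≠ P.length := fun h => h₁ (Fin.ext h)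
      have h₂ : (i : ℕ) ≠ P.length + 1 := fun h => h₂ (Fin.ext h)
      rcases lt_or_gt_of_ne h₁ with h₃ | h₃
      · simp [h₃]
      · obtain ⟨m, hm⟩ : ∃ m, (i : ℕ) = P.length + (m + 2) := ⟨i - P.length - 2, by omega⟩
        simp [hm]
  have h₁ := hF.analyticAt h hn
  have h₂ := hF.analyticAt h' hn'
  have key := hF.exchange _ _ ⟨P.length, hi⟩ ⟨P.length + 1, hj⟩ rfl h₁ (hswap ▸ h₂)
  rw [hswap] at key
  have hval : (P ++ a :: c :: Q).get (Fin.cast hn ⟨P.length, hi⟩) -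
      (P ++ a :: c :: Q).get (Fin.cast hn ⟨P.length + 1, hj⟩) = t := by
    simpa [List.getElem_append] using ht
  rw [hval] at key
  exact key h₀

/-- With left arguments shifted by `i(π - ε)` and real right arguments, all poles are avoided. -/
theorem isRegularArg_shiftedArg_append_realArg {ε : ℝ} (hε : 0 < ε ∧ ε < Real.pi) (x : Config k r)
    (L L' : List (Var k r)) : IsRegularArg (shiftedArg ε x L ++ realArg x L') := by
  have hpi := Real.pi_pos
  have him : ∀ u : Var k r,
      ((x u : ℂ) + Complex.I * Real.pi * (1 - ε / Real.pi)).im = Real.pi - ε := by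
    intro u
    have e : (x u : ℂ) + Complex.I * Real.pi * (1 - ε / Real.pi) =
        (x u : ℂ) + ((Real.pi - ε : ℝ) : ℂ) * Complex.I := by
      have : (Real.pi : ℂ) ≠ 0 := by exact_mod_cast hpi.ne'
      push_cast
      field_simp
    rw [e]
    simp
  have hne : ∀ z : ℂ, z.im < Real.pi → z ≠ Real.pi * Complex.I := by
    rintro z hz rfl
    simp at hz
  rw [IsRegularArg, List.pairwise_append]
  refine ⟨?_, ?_, ?_⟩
  · rw [shiftedArg, List.pairwise_map]
    refine List.pairwise_of_forall fun u v => ?_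
    have h₀ : (((x u : ℂ) + Complex.I * Real.pi * (1 - ε / Real.pi)) -
      ((x v : ℂ) + Complex.I * Real.pi * (1 - ε / Real.pi))).im = 0 := by
        rw [Complex.sub_im, him, him, sub_self]
    exact ⟨h₀.ge, by rw [h₀]; positivity, hne _ (by rw [h₀]; exact hpi)⟩
  · rw [realArg, List.pairwise_map]
    refine List.pairwise_of_forall fun u v => ?_
    have h₀ : ((x u : ℂ) - x v).im = 0 := by simp
    exact ⟨h₀.ge, by rw [h₀]; positivity, hne _ (by rw [h₀]; exact hpi)⟩
  · intro a ha c hc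
    simp only [shiftedArg, realArg, List.mem_map] at ha hc
    obtain ⟨u, -, rfl⟩ := ha
    obtain ⟨v, -, rfl⟩ := hc
    have h₀ : (((x u : ℂ) + Complex.I * Real.pi * (1 - ε / Real.pi)) - x v).im = Real.pi - ε := by
      rw [Complex.sub_im, him, Complex.ofReal_im, sub_zero]
    exact ⟨by rw [h₀]; linarith, by rw [h₀]; linarith, hne _ (by rw [h₀]; linarith)⟩

theorem IsFormFactor.evalF_reorder (hF : IsFormFactor b ω s w F) {ε : ℝ}
    (hε : 0 < ε ∧ ε < Real.pi) (x : Config k r) {L M L' M' : List (Var k r)} (hL : L.Nodup)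
    (h : L.Perm M) (hL' : L'.Nodup) (h' : L'.Perm M') :
    evalF F (shiftedArg ε x L ++ realArg x L') =
      permS b x L M * permS b x L' M' * evalF F (shiftedArg ε x M ++ realArg x M') := by
  have hreg := isRegularArg_shiftedArg_append_realArg hε x
  rw [eq_permS_mul_of_exchange (b := b) (x := x)
    (φ := fun L => evalF F (shiftedArg ε x L ++ realArg x L')) ?_ hL h,
    eq_permS_mul_of_exchange (b := b) (x := x)
    (φ := fun L' => evalF F (shiftedArg ε x M ++ realArg x L')) ?_ hL' h', mul_assoc]
  · intro P u v Q
    have := hF.evalF_exchange (P := shiftedArg ε x M ++ realArg x P) (Q := realArg x Q)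
      (a := x u) (c := x v) (t := x u - x v)
      (by simpa [realArg] using hreg M (P ++ u :: v :: Q))
      (by simpa [realArg] using hreg M (P ++ v :: u :: Q)) (by push_cast; ring)
    simpa [realArg, pairS] using this
  · intro P u v Q
    have := hF.evalF_exchange (P := shiftedArg ε x P) (Q := shiftedArg ε x Q ++ realArg x L')
      (a := (x u : ℂ) + Complex.I * Real.pi * (1 - ε / Real.pi))
      (c := (x v : ℂ) + Complex.I * Real.pi * (1 - ε / Real.pi)) (t := x u - x v)
      (by simpa [shiftedArg] using hreg (P ++ u :: v :: Q) L')
      (by simpa [shiftedArg] using hreg (P ++ v :: u :: Q) L') (by push_cast; ring)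
    simpa [shiftedArg, pairS] using this

theorem continuous_evalF_shiftedArg_append_realArg (hF : IsFormFactor b ω s w F) {ε : ℝ}
    (hε : 0 < ε ∧ ε < Real.pi) (L L' : List (Var k r)) :
    Continuous fun x : Config k r => evalF F (shiftedArg ε x L ++ realArg x L') := by
  have hn : ∀ x : Config k r, L.length + L'.length = (shiftedArg ε x L ++ realArg x L').length := by
    intro x; simp [shiftedArg, realArg]
  have e : (fun x : Config k r => evalF F (shiftedArg ε x L ++ realArg x L')) =
      fun x => F (L.length + L'.length)
        (fun i => (shiftedArg ε x L ++ realArg x L').get (i.cast (hn x))) := by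
    funext x
    exact evalF_eq F _ (hn x)
  rw [e, continuous_iff_continuousAt]
  intro x
  have h₁ := (hF.analyticAt (isRegularArg_shiftedArg_append_realArg hε x L L') (hn x)).continuousAt
  refine ContinuousAt.comp (g := F (L.length + L'.length)) h₁ (Continuous.continuousAt ?_)
  refine continuous_pi fun i => ?_
  have hi : ∀ y : Config k r, (shiftedArg ε y L ++ realArg y L').get (i.cast (hn y)) =
      if h : (i : ℕ) < L.length then
        (y (L[(i : ℕ)]) : ℂ) + Complex.I * Real.pi * (1 - ε / Real.pi)
      else (y (L'[(i : ℕ) - L.length]'(by omega)) : ℂ) := by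
    intro y
    simp only [List.get_eq_getElem, List.getElem_append, shiftedArg, realArg, List.getElem_map,
      List.length_map]
    rfl
  simp only [hi]
  split_ifs <;> fun_prop

end Exchange

/-! ### Generalised functions: well-definedness and equality -/

section Analysis

open MeasureTheory

variable {k : ℕ} {r : ℕ → ℕ}

/-- The coefficients of the products of Dirac masses are continuous functions. -/
def HasContinuousCoeff (T : GenFun k r) : Prop := ∀ E, Continuous (T.coeff E)

theorem hasContinuousCoeff_ofFun {h : Config k r → ℂ} (hh : Continuous h) :
    HasContinuousCoeff (ofFun h) := by
  intro E
  rw [ofFun, MvPolynomial.coeff_C]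
  split_ifs
  · exact hh
  · exact continuous_const

theorem hasContinuousCoeff_X (uv : Var k r × Var k r) :
    HasContinuousCoeff (MvPolynomial.X uv : GenFun k r) := by
  classical
  intro E
  rw [MvPolynomial.coeff_X]
  split_ifs
  · exact continuous_const
  · exact continuous_const

theorem HasContinuousCoeff.add {T T' : GenFun k r} (h : HasContinuousCoeff T)
    (h' : HasContinuousCoeff T') : HasContinuousCoeff (T + T') := by
  intro E
  rw [MvPolynomial.coeff_add]
  exact (h E).add (h' E)

theorem HasContinuousCoeff.mul {T T' : GenFun k r} (h : HasContinuousCoeff T)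
    (h' : HasContinuousCoeff T') : HasContinuousCoeff (T * T') := by
  classical
  intro E
  rw [MvPolynomial.coeff_mul]
  convert continuous_finsetSum (Finset.HasAntidiagonal.antidiagonal E)
    fun i _ => (h i.1).mul (h' i.2) using 1
  funext x
  simp [Finset.sum_apply]

theorem hasContinuousCoeff_zero : HasContinuousCoeff (0 : GenFun k r) := fun _ => continuous_const

theorem hasContinuousCoeff_sum {ι : Type*} {s : Finset ι} {T : ι → GenFun k r}
    (h : ∀ i ∈ s, HasContinuousCoeff (T i)) : HasContinuousCoeff (∑ i ∈ s, T i) :=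
  Finset.sum_induction _ _ (fun _ _ => HasContinuousCoeff.add) hasContinuousCoeff_zero h

theorem hasContinuousCoeff_one : HasContinuousCoeff (1 : GenFun k r) := by
  have := hasContinuousCoeff_ofFun (k := k) (r := r) (h := 1) continuous_const
  simpa [ofFun] using this

theorem hasContinuousCoeff_prod {ι : Type*} {s : Finset ι} {T : ι → GenFun k r}
    (h : ∀ i ∈ s, HasContinuousCoeff (T i)) : HasContinuousCoeff (∏ i ∈ s, T i) :=
  Finset.prod_induction _ _ (fun _ _ => HasContinuousCoeff.mul) hasContinuousCoeff_one h

theorem hasContinuousCoeff_Delta (L L' : List (Var k r)) : HasContinuousCoeff (Delta L L') := by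
  unfold Delta
  refine List.prod_induction _ (fun _ _ => HasContinuousCoeff.mul) hasContinuousCoeff_one ?_
  intro T hT
  obtain ⟨uv, -, rfl⟩ := List.mem_map.1 hT
  exact (hasContinuousCoeff_ofFun continuous_const).mul (hasContinuousCoeff_X uv)

/-- The subspace on which the variables tied by `E` coincide is closed and linearly parametrised by
the common values. -/
theorem isClosedEmbedding_comp_quotMk (E : Finset (Var k r × Var k r)) :
    Topology.IsClosedEmbedding
      (fun (y : Quot (fun u v => (u, v) ∈ E) → ℝ) (v : Var k r) => y (Quot.mk _ v)) := by
  let _ : Fintype (Quot (fun u v => (u, v) ∈ E)) := Fintype.ofFinite _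
  refine LinearMap.isClosedEmbedding_of_injective (𝕜 := ℝ)
    (f := LinearMap.funLeft ℝ ℝ (Quot.mk (fun u v => (u, v) ∈ E))) ?_
  exact LinearMap.ker_eq_bot.2 (LinearMap.funLeft_injective_of_surjective _ _ _ Quot.mk_surjective)

instance isFiniteMeasureOnCompacts_diracMeasure (E : Finset (Var k r × Var k r)) :
    IsFiniteMeasureOnCompacts (diracMeasure E) where
  lt_top_of_isCompact K hK := by
    let _ : Fintype (Quot (fun u v => (u, v) ∈ E)) := Fintype.ofFinite _
    have hj := isClosedEmbedding_comp_quotMk E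
    have e : diracMeasure E K = volume ((fun (y : Quot (fun u v => (u, v) ∈ E) → ℝ)
        (v : Var k r) => y (Quot.mk _ v)) ⁻¹' K) :=
      Measure.map_apply hj.continuous.measurable hK.measurableSet
    rw [e]
    exact (hj.isCompact_preimage hK).measure_lt_top

theorem HasContinuousCoeff.isWellDefined {T : GenFun k r} (h : HasContinuousCoeff T) :
    IsWellDefined T := fun E _ => (h E).locallyIntegrable

theorem integral_diracMeasure_congr {E : Finset (Var k r × Var k r)} {f g : Config k r → ℂ}
    (h : ∀ x : Config k r, (∀ uv ∈ E, x uv.1 = x uv.2) → f x = g x) :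
    ∫ x, f x ∂(diracMeasure E) = ∫ x, g x ∂(diracMeasure E) := by
  let _ : Fintype (Quot (fun u v => (u, v) ∈ E)) := Fintype.ofFinite _
  have hj := (isClosedEmbedding_comp_quotMk E).measurableEmbedding
  have e : ∀ f : Config k r → ℂ, ∫ x, f x ∂(diracMeasure E) =
      ∫ y : Quot (fun u v => (u, v) ∈ E) → ℝ, f (fun v => y (Quot.mk _ v)) := fun f =>
    hj.integral_map f
  rw [e, e]
  refine integral_congr_ae (Filter.Eventually.of_forall fun y => h _ ?_)
  rintro ⟨u, v⟩ huv
  exact congrArg y (Quot.sound huv)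

/-- The restriction of a generalised function to a configuration `x`: coefficients are evaluated at
`x`, and a Dirac mass `δ_{u;v}` is dropped unless `x u = x v`. -/
noncomputable def restrict (x : Config k r) :
    GenFun k r →+* MvPolynomial (Var k r × Var k r) ℂ :=
  MvPolynomial.eval₂Hom (MvPolynomial.C.comp (Pi.evalRingHom (fun _ => ℂ) x))
    (fun uv => if x uv.1 = x uv.2 then MvPolynomial.X uv else 0)

theorem restrict_ofFun (x : Config k r) (h : Config k r → ℂ) :
    restrict x (ofFun h) = MvPolynomial.C (h x) := by
  simp [restrict, ofFun]

theorem restrict_X (x : Config k r) (uv : Var k r × Var k r) :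
    restrict x (MvPolynomial.X uv) = if x uv.1 = x uv.2 then MvPolynomial.X uv else 0 := by
  simp [restrict]

theorem coeff_restrict (x : Config k r) (T : GenFun k r) (E : Var k r × Var k r →₀ ℕ)
    (hE : ∀ uv ∈ E.support, x uv.1 = x uv.2) : (restrict x T).coeff E = T.coeff E x := by
  classical
  induction T using MvPolynomial.induction_on' with
  | monomial d c =>
    have e : restrict x (MvPolynomial.monomial d c) = MvPolynomial.C (c x) *
        ∏ uv ∈ d.support, (if x uv.1 = x uv.2 then MvPolynomial.X uv else 0) ^ d uv := by
      simp [restrict, MvPolynomial.eval₂_monomial, Finsupp.prod]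
    rw [e, MvPolynomial.coeff_C_mul, MvPolynomial.coeff_monomial]
    by_cases hd : ∀ uv ∈ d.support, x uv.1 = x uv.2
    · have e' : ∏ uv ∈ d.support, (if x uv.1 = x uv.2 then MvPolynomial.X uv else 0) ^ d uv =
          (MvPolynomial.monomial d (1 : ℂ)) := by
        rw [MvPolynomial.monomial_eq, Finsupp.prod, MvPolynomial.C_1, one_mul]
        exact Finset.prod_congr rfl fun uv huv => by rw [if_pos (hd uv huv)]
      rw [e', MvPolynomial.coeff_monomial]
      split_ifs <;> simp
    · have hne : d ≠ E := by rintro rfl; exact hd hE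
      push Not at hd
      obtain ⟨uv, huv, hx⟩ := hd
      rw [Finset.prod_eq_zero huv (by rw [if_neg hx, zero_pow (Finsupp.mem_support_iff.1 huv)]),
        if_neg hne]
      simp
  | add p q hp hq =>
    rw [map_add, MvPolynomial.coeff_add, MvPolynomial.coeff_add, hp, hq]
    rfl

/-- Two generalised functions define the same distribution if all their restrictions agree: the
Dirac masses only see the coefficients at configurations where the tied variables coincide. -/
theorem pair_eq_of_restrict_eq {T T' : GenFun k r} (h : ∀ x, restrict x T = restrict x T')
    (φ : Config k r → ℂ) : pair T φ = pair T' φ := by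
  classical
  have key : ∀ E : Var k r × Var k r →₀ ℕ, ∫ x, T.coeff E x * φ x ∂(diracMeasure E.support) =
      ∫ x, T'.coeff E x * φ x ∂(diracMeasure E.support) := fun E =>
    integral_diracMeasure_congr fun x hx => by
      rw [← coeff_restrict x T E hx, ← coeff_restrict x T' E hx, h]
  have hz : ∀ (S : GenFun k r) (E : Var k r × Var k r →₀ ℕ), E ∉ S.support →
      ∫ x, S.coeff E x * φ x ∂(diracMeasure E.support) = 0 := by
    intro S E hE
    rw [MvPolynomial.notMem_support_iff.1 hE]
    simp
  unfold pair
  rw [Finset.sum_subset (Finset.subset_union_left (s₂ := T'.support)) fun E _ hE => hz T E hE,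
    Finset.sum_subset (Finset.subset_union_right (s₁ := T.support)) fun E _ hE => hz T' E hE]
  exact Finset.sum_congr rfl fun E _ => key E

/-! ### Continuity of the coefficients -/

theorem continuous_permS (b : ℝ) (L L' : List (Var k r)) :
    Continuous fun x : Config k r => permS b x L L' := by
  unfold permS
  refine continuous_finsetProd _ fun uv _ => ?_
  unfold sMat
  split_ifs with h
  · exact continuous_const
  · refine Continuous.div (by fun_prop) (by fun_prop) fun x => sMat_denom_ne_zero h _

theorem hasTemperateGrowth_volume_pi_prod :
    (volume : Measure (Fin k → ℝ × ℝ)).HasTemperateGrowth := by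
  have : (volume : Measure (ℝ × ℝ)).IsAddHaarMeasure := by
    rw [Measure.volume_eq_prod]; infer_instance
  have : (volume : Measure (Fin k → ℝ × ℝ)).IsAddHaarMeasure := by
    rw [volume_pi]; infer_instance
  infer_instance

theorem continuous_integral_schwartz_mul_exp (G : 𝓢(Fin k → ℝ × ℝ, ℂ))
    {P : Config k r → (Fin k → ℝ × ℝ) → ℝ} (hP : Continuous fun q : Config k r × _ => P q.1 q.2) :
    Continuous fun x : Config k r =>
      ∫ y : Fin k → ℝ × ℝ, G y * Complex.exp (Complex.I * P x y) := by
  have hG : Continuous G := G.continuous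
  have := hasTemperateGrowth_volume_pi_prod (k := k)
  refine continuous_of_dominated (bound := fun y => ‖G y‖) ?_ ?_ G.integrable.norm ?_
  · intro x
    refine Continuous.aestronglyMeasurable (Continuous.mul hG ?_)
    have : Continuous fun y => P x y := hP.comp (Continuous.prodMk_right x)
    fun_prop
  · intro x
    refine Filter.Eventually.of_forall fun y => ?_
    rw [norm_mul, mul_comm Complex.I, Complex.norm_exp_ofReal_mul_I, mul_one]
  · refine Filter.Eventually.of_forall fun y => ?_
    have : Continuous fun x => P x y := hP.comp (Continuous.prodMk_left y)
    fun_prop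

theorem continuous_pt (s : ℕ) : Continuous fun y : Fin k → ℝ × ℝ => pt y s := by
  unfold pt
  split_ifs <;> fun_prop

theorem continuous_momentum (m : ℝ) (X : Finset (Var k r)) :
    Continuous fun x : Config k r => momentum m x X := by
  unfold momentum
  have h₁ : Continuous Real.cosh := Real.continuous_cosh
  have h₂ : Continuous Real.sinh := Real.continuous_sinh
  fun_prop

theorem continuous_mink_momentum (m : ℝ) (X : Finset (Var k r)) {z : (Fin k → ℝ × ℝ) → ℝ × ℝ}
    (hz : Continuous z) :
    Continuous fun q : Config k r × (Fin k → ℝ × ℝ) => mink (momentum m q.1 X) (z q.2) := by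
  have h₁ := (continuous_momentum m X).comp
    (continuous_fst : Continuous fun q : Config k r × (Fin k → ℝ × ℝ) => q.1)
  have h₂ := hz.comp (continuous_snd : Continuous fun q : Config k r × (Fin k → ℝ × ℝ) => q.2)
  unfold mink
  exact (h₁.fst.mul h₂.fst).sub (h₁.snd.mul h₂.snd)

theorem continuous_totalR (m : ℝ) (G : 𝓢(Fin k → ℝ × ℝ, ℂ)) :
    Continuous fun x : Config k r => totalR m G x := by
  refine continuous_integral_schwartz_mul_exp G ?_
  unfold totalP
  refine Continuous.sub (Continuous.add ?_ (continuous_finsetSum _ fun p _ => ?_)) ?_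
  · exact continuous_mink_momentum m _ (continuous_pt _)
  · exact continuous_mink_momentum m _ ((continuous_pt _).sub (continuous_pt _))
  · exact continuous_mink_momentum m _ (continuous_pt _)

theorem continuous_refinedR (m : ℝ) (G : 𝓢(Fin k → ℝ × ℝ, ℂ)) (c : Blocks k r) :
    Continuous fun x : Config k r => refinedR m G c x := by
  refine continuous_integral_schwartz_mul_exp G ?_
  unfold refinedP
  refine Continuous.sub (continuous_finsetSum _ fun u _ => continuous_finsetSum _ fun s _ => ?_)
    (continuous_finsetSum _ fun s _ => ?_)
  · exact continuous_mink_momentum m _ ((continuous_pt _).sub (continuous_pt _))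
  · exact continuous_mink_momentum m _ (continuous_pt _)

variable {b m : ℝ} {ω : ℕ → ℝ} {spin : ℕ → ℂ} {w : ℕ → ℝ}
  {F : ℕ → (n : ℕ) → (Fin n → ℂ) → ℂ} {ε : ℕ → ℝ}

theorem hasContinuousCoeff_Gtot
    (hF : ∀ p ∈ Finset.Icc 1 k, IsFormFactor b (ω p) (spin p) (w p) (F p))
    (hε : ∀ p ∈ Finset.Icc 1 k, 0 < ε p ∧ ε p < Real.pi) (G : 𝓢(Fin k → ℝ × ℝ, ℂ)) :
    HasContinuousCoeff (Gtot b m ω F ε G : GenFun k r) := by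
  refine HasContinuousCoeff.mul (hasContinuousCoeff_prod fun l hl => ?_)
    (hasContinuousCoeff_ofFun (continuous_totalR m G))
  refine HasContinuousCoeff.mul (hasContinuousCoeff_ofFun continuous_const) ?_
  refine hasContinuousCoeff_sum fun A₁ _ => hasContinuousCoeff_sum fun B₁ _ =>
    hasContinuousCoeff_sum fun σ _ => ?_
  refine (hasContinuousCoeff_Delta _ _).mul (hasContinuousCoeff_ofFun ?_)
  exact ((continuous_permS b _ _).mul (continuous_permS b _ _)).mul
    (continuous_evalF_shiftedArg_append_realArg (hF l hl) (hε l hl) _ _)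

theorem hasContinuousCoeff_refinedSum
    (hF : ∀ p ∈ Finset.Icc 1 k, IsFormFactor b (ω p) (spin p) (w p) (F p))
    (hε : ∀ p ∈ Finset.Icc 1 k, 0 < ε p ∧ ε p < Real.pi) (G : 𝓢(Fin k → ℝ × ℝ, ℂ)) :
    HasContinuousCoeff (refinedSum b m ω F ε G : GenFun k r) := by
  refine HasContinuousCoeff.mul (hasContinuousCoeff_ofFun continuous_const) ?_
  refine hasContinuousCoeff_sum fun c _ => hasContinuousCoeff_sum fun σ _ =>
    hasContinuousCoeff_sum fun τ _ => ?_
  refine HasContinuousCoeff.mul (HasContinuousCoeff.mul (HasContinuousCoeff.mul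
    (HasContinuousCoeff.mul (hasContinuousCoeff_ofFun ?_)
      (hasContinuousCoeff_prod fun i _ => hasContinuousCoeff_Delta _ _))
      (hasContinuousCoeff_prod fun i _ => hasContinuousCoeff_Delta _ _))
      (hasContinuousCoeff_ofFun ?_)) (hasContinuousCoeff_ofFun (continuous_refinedR m G c))
  · unfold refinedS
    refine Continuous.mul (Continuous.mul (continuous_permS b _ _) ?_) ?_
    · exact continuous_finsetProd _ fun _ _ => continuous_finsetProd _ fun _ _ =>
        continuous_finsetProd _ fun _ _ => continuous_permS b _ _
    · exact continuous_finsetProd _ fun _ _ => continuous_finsetProd _ fun _ _ =>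
        continuous_finsetProd _ fun _ _ => continuous_finsetProd _ fun _ _ =>
        continuous_permS b _ _
  · exact continuous_finsetProd _ fun p hp =>
      continuous_evalF_shiftedArg_append_realArg (hF p hp) (hε p hp) _ _

end Analysis

/-! ### Chains of tied variables -/

section Chains

variable {k : ℕ} {r : ℕ → ℕ} {f : Var k r → Var k r} {c : Blocks k r} {v w : Var k r}

theorem mem_setA {p : ℕ} : v ∈ (setA p : Finset (Var k r)) ↔ (v.1 : ℕ) = p := by simp [setA]

theorem mem_blockA {p s : ℕ} :
    v ∈ blockA c p s ↔ (v.1 : ℕ) = p ∧ ((c v).1 : ℕ) = s ∧ (c v).2 = false := by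
  simp [blockA, mem_setA]

theorem mem_blockγ {u s : ℕ} :
    v ∈ blockγ c u s ↔ (v.1 : ℕ) = u - 1 ∧ ((c v).1 : ℕ) = s ∧ (c v).2 = true := by
  simp [blockγ, mem_setA]

theorem level_le (v : Var k r) : (v.1 : ℕ) ≤ k := by omega

theorem one_le_level (hr : r 0 = 0) (v : Var k r) : 1 ≤ (v.1 : ℕ) := by
  rcases v with ⟨⟨p, hp⟩, a⟩
  rcases p with _ | p
  · exact absurd a.2 (by simp [hr])
  · simp

/-- A collection of matchings between consecutive levels, encoded by the map `f` that sends a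
variable to the variable of the next level tied to it, or to itself if there is none. -/
structure IsLink (f : Var k r → Var k r) : Prop where
  level : ∀ v, f v ≠ v → ((f v).1 : ℕ) = v.1 + 1
  inj : ∀ v w, f v ≠ v → f w ≠ w → f v = f w → v = w

/-- The variables of level `p` tied to a variable of level `p + 1`. -/
def contA (f : Var k r → Var k r) (p : ℕ) : Finset (Var k r) := (setA p).filter (fun v => f v ≠ v)

theorem mem_contA {p : ℕ} : v ∈ contA f p ↔ (v.1 : ℕ) = p ∧ f v ≠ v := by simp [contA, mem_setA]

/-- The last variable of the chain of tied variables that contains `v`. -/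
def chainEnd (f : Var k r → Var k r) (v : Var k r) : Var k r := f^[k + 1] v

namespace IsLink

theorem le_level_iterate (hf : IsLink f) (n : ℕ) (v : Var k r) :
    (v.1 : ℕ) ≤ ((f^[n] v).1 : ℕ) := by
  induction n generalizing v with
  | zero => rfl
  | succ n ih =>
    rw [Function.iterate_succ_apply]
    by_cases h : f v = v
    · rw [h]; exact ih v
    · have := hf.level v h
      have := ih (f v)
      omega

theorem apply_chainEnd (hf : IsLink f) (v : Var k r) : f (chainEnd f v) = chainEnd f v := by
  have key : ∀ n, f (f^[n] v) = f^[n] v ∨ ((f^[n] v).1 : ℕ) = v.1 + n := by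
    intro n
    induction n with
    | zero => exact Or.inr rfl
    | succ n ih =>
      rw [Function.iterate_succ_apply']
      by_cases h : f (f^[n] v) = f^[n] v
      · rw [h]; exact Or.inl h
      · have h₁ := hf.level _ h
        have h₂ := ih.resolve_left h
        exact Or.inr (by omega)
  have h₁ := level_le (f^[k + 1] v)
  exact (key (k + 1)).resolve_right (by omega)

theorem chainEnd_apply (hf : IsLink f) (v : Var k r) : chainEnd f (f v) = chainEnd f v := by
  have := hf.apply_chainEnd v
  rw [chainEnd, ← Function.iterate_succ_apply, Function.iterate_succ_apply']
  exact this

theorem chainEnd_eq_self (h : f v = v) : chainEnd f v = v := Function.iterate_fixed h _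

theorem level_le_level_chainEnd (hf : IsLink f) (v : Var k r) :
    (v.1 : ℕ) ≤ ((chainEnd f v).1 : ℕ) := hf.le_level_iterate _ v

theorem level_lt_level_chainEnd (hf : IsLink f) (h : f v ≠ v) :
    (v.1 : ℕ) < ((chainEnd f v).1 : ℕ) := by
  have h₁ := hf.level v h
  have h₂ := hf.level_le_level_chainEnd (f v)
  rw [hf.chainEnd_apply] at h₂
  omega

/-- Two different variables of the same level belong to different chains. -/
theorem eq_of_chainEnd_eq (hf : IsLink f) (hl : (v.1 : ℕ) = w.1)
    (h : chainEnd f v = chainEnd f w) : v = w := by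
  suffices H : ∀ n, ∀ v w : Var k r, (v.1 : ℕ) = w.1 → f^[n] v = f^[n] w → v = w from H _ v w hl h
  intro n
  induction n with
  | zero => exact fun v w _ h => h
  | succ n ih =>
    intro v w hl h
    rw [Function.iterate_succ_apply, Function.iterate_succ_apply] at h
    by_cases hv : f v = v <;> by_cases hw : f w = w
    · rw [hv, hw] at h; exact ih v w hl h
    · have h₁ := hf.level w hw
      have h₂ := hf.le_level_iterate n (f w)
      rw [← h, hv, Function.iterate_fixed hv] at h₂
      omega
    · have h₁ := hf.level v hv
      have h₂ := hf.le_level_iterate n (f v)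
      rw [h, hw, Function.iterate_fixed hw] at h₂
      omega
    · have h₁ := hf.level v hv
      have h₂ := hf.level w hw
      exact hf.inj v w hv hw (ih _ _ (by omega) h)

theorem apply_eq_self (hf : IsLink f) (h : (v.1 : ℕ) = k) : f v = v := by
  by_contra hv
  have := hf.level v hv
  have := level_le (f v)
  omega

theorem injOn_contA (hf : IsLink f) (p : ℕ) : Set.InjOn f (contA f p) := fun v hv w hw h =>
  hf.inj v w (mem_contA.1 hv).2 (mem_contA.1 hw).2 h

end IsLink

theorem comp_chainEnd {x : Config k r} (hx : ∀ v, x (f v) = x v) (v : Var k r) :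
    x (chainEnd f v) = x v := by
  have : ∀ n, x (f^[n] v) = x v := by
    intro n
    induction n with
    | zero => rfl
    | succ n ih => rw [Function.iterate_succ_apply', hx, ih]
  exact this _

/-! ### The refined partition of a family of matchings -/

/-- The partition `c` is the one induced by the chains of `f`: the index of the block of a variable
is the level at which its chain starts, and the variable lies in a block `γ` if its chain ends there
before level `k`. -/
structure IsCompatible (c : Blocks k r) (f : Var k r → Var k r) : Prop where
  next : ∀ v, f v ≠ v → (c (f v)).1 = (c v).1
  start : ∀ w, (∀ v, f v ≠ v → f v ≠ w) → ((c w).1 : ℕ) = w.1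
  flag : ∀ v, (c v).2 = true ↔ (v.1 : ℕ) < k ∧ f v = v

/-- The starting level of the chain of a variable, obtained by following the chain backwards for
at most `n` steps. -/
noncomputable def chainStart (f : Var k r → Var k r) : ℕ → Var k r → Fin (k + 1)
  | 0, w => w.1
  | n + 1, w =>
    open Classical in
    if h : ∃ v, f v ≠ v ∧ f v = w then chainStart f n h.choose else w.1

theorem IsLink.exists_isCompatible (hf : IsLink f) : ∃ c : Blocks k r, IsCompatible c f := by
  refine ⟨fun w => (chainStart f w.1 w, decide ((w.1 : ℕ) < k ∧ f w = w)), ?_, ?_, ?_⟩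
  · intro v hv
    have hex : ∃ u, f u ≠ u ∧ f u = f v := ⟨v, hv, rfl⟩
    have hu : hex.choose = v := hf.inj _ _ hex.choose_spec.1 hv hex.choose_spec.2
    simp only [hf.level v hv, chainStart]
    rw [dif_pos hex, hu]
  · intro w hw
    have hex : ¬ ∃ v, f v ≠ v ∧ f v = w := fun ⟨v, h, h'⟩ => hw v h h'
    simp only
    cases h : (w.1 : ℕ) with
    | zero => simp [chainStart, h]
    | succ n => rw [chainStart, dif_neg hex, h]
  · intro v
    simp

namespace IsCompatible

theorem start_le (hf : IsLink f) (hc : IsCompatible c f) (w : Var k r) :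
    ((c w).1 : ℕ) ≤ w.1 := by
  induction hn : (w.1 : ℕ) using Nat.strong_induction_on generalizing w with
  | _ n ih =>
    by_cases h : ∃ v, f v ≠ v ∧ f v = w
    · obtain ⟨v, hv, rfl⟩ := h
      have h₁ := hf.level v hv
      have h₂ := ih v.1 (by omega) v rfl
      rw [hc.next v hv]
      omega
    · exact (hc.start w fun v hv hvw => h ⟨v, hv, hvw⟩).le.trans hn.le

theorem start_lt_iff (hf : IsLink f) (hc : IsCompatible c f) (w : Var k r) :
    ((c w).1 : ℕ) < w.1 ↔ ∃ v, f v ≠ v ∧ f v = w := by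
  constructor
  · intro h
    by_contra hne
    have := hc.start w fun v hv hvw => hne ⟨v, hv, hvw⟩
    omega
  · rintro ⟨v, hv, rfl⟩
    have h₁ := hf.level v hv
    have h₂ := hc.start_le hf v
    rw [hc.next v hv]
    omega

theorem unique (hf : IsLink f) {c c' : Blocks k r} (hc : IsCompatible c f)
    (hc' : IsCompatible c' f) : c = c' := by
  have h₁ : ∀ w, (c w).1 = (c' w).1 := by
    intro w
    induction hn : (w.1 : ℕ) using Nat.strong_induction_on generalizing w with
    | _ n ih =>
      by_cases h : ∃ v, f v ≠ v ∧ f v = w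
      · obtain ⟨v, hv, rfl⟩ := h
        have h₁ := hf.level v hv
        rw [hc.next v hv, hc'.next v hv]
        exact ih v.1 (by omega) v rfl
      · have h' : ∀ v, f v ≠ v → f v ≠ w := fun v hv hvw => h ⟨v, hv, hvw⟩
        exact Fin.ext ((hc.start w h').trans (hc'.start w h').symm)
  funext w
  refine Prod.ext (h₁ w) ?_
  rw [Bool.eq_iff_iff, hc.flag, hc'.flag]

theorem one_le_start (hr : r 0 = 0) (hc : IsCompatible c f) (hf : IsLink f) (w : Var k r) :
    1 ≤ ((c w).1 : ℕ) := by
  induction hn : (w.1 : ℕ) using Nat.strong_induction_on generalizing w with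
  | _ n ih =>
    by_cases h : ∃ v, f v ≠ v ∧ f v = w
    · obtain ⟨v, hv, rfl⟩ := h
      have h₁ := hf.level v hv
      rw [hc.next v hv]
      exact ih v.1 (by omega) v rfl
    · rw [hc.start w fun v hv hvw => h ⟨v, hv, hvw⟩]
      exact one_le_level hr w

theorem start_iterate (hc : IsCompatible c f) (n : ℕ) (v : Var k r) :
    (c (f^[n] v)).1 = (c v).1 := by
  induction n with
  | zero => rfl
  | succ n ih =>
    rw [Function.iterate_succ_apply']
    by_cases h : f (f^[n] v) = f^[n] v
    · rw [h, ih]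
    · rw [hc.next _ h, ih]

theorem start_chainEnd (hc : IsCompatible c f) (v : Var k r) :
    (c (chainEnd f v)).1 = (c v).1 := hc.start_iterate _ v

theorem flag_eq_false (hc : IsCompatible c f) (v : Var k r) :
    (c v).2 = false ↔ ((v.1 : ℕ) < k → f v ≠ v) := by
  rw [← Bool.not_eq_true, hc.flag]
  tauto

/-- A chain visits all levels between those of its first and last variables. -/
theorem exists_level_eq (hf : IsLink f) (hc : IsCompatible c f) {q : ℕ} (w : Var k r)
    (h₁ : ((c w).1 : ℕ) ≤ q) (h₂ : q ≤ w.1) :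
    ∃ v : Var k r, (v.1 : ℕ) = q ∧ chainEnd f v = chainEnd f w := by
  obtain ⟨d, hd⟩ := Nat.exists_eq_add_of_le h₂
  induction d generalizing w with
  | zero => exact ⟨w, by omega, rfl⟩
  | succ d ih =>
    obtain ⟨v, hv, rfl⟩ := (hc.start_lt_iff hf w).1 (by omega)
    have h₃ := hf.level v hv
    rw [hc.next v hv] at h₁
    obtain ⟨u, hu, hu'⟩ := ih v h₁ (by omega) (by omega)
    exact ⟨u, hu, by rw [hu', hf.chainEnd_apply]⟩

theorem mem_blockA_iff (hc : IsCompatible c f) {p s : ℕ} (hp : p < k) :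
    v ∈ blockA c p s ↔ v ∈ contA f p ∧ ((c v).1 : ℕ) = s := by
  rw [mem_blockA, hc.flag_eq_false, mem_contA]
  constructor
  · rintro ⟨rfl, h₂, h₃⟩; exact ⟨⟨rfl, h₃ hp⟩, h₂⟩
  · rintro ⟨⟨h₁, h₃⟩, h₂⟩; exact ⟨h₁, h₂, fun _ => h₃⟩

/-- The images of the variables of `A_s^{(p)}` are those variables of level `p + 1` whose chain
starts at level `s`. -/
theorem image_blockA (hf : IsLink f) (hc : IsCompatible c f) {p s : ℕ} (hp : p < k)
    (hs : s ≤ p) : (blockA c p s).image f = blockA c (p + 1) s ∪ blockγ c (p + 2) s := by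
  ext w
  simp only [Finset.mem_image, Finset.mem_union, hc.mem_blockA_iff hp, mem_contA]
  rw [mem_blockA, mem_blockγ, show p + 2 - 1 = p + 1 from rfl, ← and_or_left, ← and_or_left]
  constructor
  · rintro ⟨v, ⟨⟨h₁, h₂⟩, h₃⟩, rfl⟩
    have := hf.level v h₂
    exact ⟨by omega, by rw [hc.next v h₂, h₃], by cases (c (f v)).2 <;> simp⟩
  · rintro ⟨h₁, h₂, -⟩
    obtain ⟨v, hv, rfl⟩ := (hc.start_lt_iff hf w).1 (by omega)
    have := hf.level v hv
    rw [hc.next v hv] at h₂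
    exact ⟨v, ⟨⟨by omega, hv⟩, h₂⟩, rfl⟩

theorem injOn_blockA (hf : IsLink f) (hc : IsCompatible c f) {p s : ℕ} (hp : p < k) :
    Set.InjOn f (blockA c p s) := fun _ hv _ hw h =>
  hf.injOn_contA p ((hc.mem_blockA_iff hp).1 hv).1 ((hc.mem_blockA_iff hp).1 hw).1 h

theorem blockγ_succ_last (hc : IsCompatible c f) (s : ℕ) : blockγ c (k + 1) s = ∅ := by
  ext v
  simp only [mem_blockγ, Finset.notMem_empty, iff_false, hc.flag]
  omega

theorem isRefined (hr : r 0 = 0) (hf : IsLink f) (hc : IsCompatible c f) : IsRefined c where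
  index v := ⟨hc.one_le_start hr hf v, hc.start_le hf v⟩
  last v hv := by
    rw [hc.flag_eq_false]
    have := mem_setA.1 hv
    omega
  card_inner p s hp hpk hs hsp := by
    obtain ⟨p, rfl⟩ : ∃ q, p = q + 1 := ⟨p - 1, by omega⟩
    rw [Nat.add_sub_cancel, ← Finset.card_image_of_injOn (hc.injOn_blockA hf (by omega)),
      hc.image_blockA hf (by omega) (by omega)]
  card_outer s hs hsk := by
    obtain ⟨q, hq⟩ : ∃ q, k = q + 1 := ⟨k - 1, by omega⟩
    have h₁ := hc.blockγ_succ_last s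
    rw [← Finset.card_image_of_injOn (hc.injOn_blockA (p := k - 1) hf (by omega)),
      hc.image_blockA hf (by omega) (by omega), show k - 1 + 2 = k + 1 by omega, h₁,
      Finset.union_empty, show k - 1 + 1 = k by omega]
    rfl

end IsCompatible

/-! ### Comparison of the phases -/

theorem sum_apply_eq_sum_image {M : Type*} [AddCommMonoid M] (hf : IsLink f) (g : Var k r → M) :
    ∑ v ∈ Finset.univ.filter (fun v => ¬ f v = v), g (f v) =
      ∑ w ∈ Finset.univ.filter (fun w => ∃ v, f v ≠ v ∧ f v = w), g w := by
  refine Finset.sum_bij (fun v _ => f v) ?_ ?_ ?_ fun v _ => rfl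
  · intro v hv
    simp only [Finset.mem_filter, Finset.mem_univ, true_and] at hv ⊢
    exact ⟨v, hv, rfl⟩
  · intro v hv w hw h
    simp only [Finset.mem_filter, Finset.mem_univ, true_and] at hv hw
    exact hf.inj v w hv hw h
  · intro w hw
    simp only [Finset.mem_filter, Finset.mem_univ, true_and] at hw
    obtain ⟨v, hv, rfl⟩ := hw
    exact ⟨v, by simpa using hv, rfl⟩

/-- Every chain has one first and one last variable. -/
theorem sum_chainEnds_eq_sum_chainStarts {M : Type*} [AddCommGroup M] (hf : IsLink f)
    {g : Var k r → M} (hg : ∀ v, f v ≠ v → g (f v) = g v) :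
    ∑ v ∈ Finset.univ.filter (fun v => f v = v), g v =
      ∑ w ∈ Finset.univ.filter (fun w => ¬ ∃ v, f v ≠ v ∧ f v = w), g w := by
  have h₁ := Finset.sum_filter_add_sum_filter_not Finset.univ (fun v => f v = v) g
  have h₂ := Finset.sum_filter_add_sum_filter_not Finset.univ
    (fun w => ∃ v, f v ≠ v ∧ f v = w) g
  have h₃ := sum_apply_eq_sum_image hf g
  rw [Finset.sum_congr rfl fun v hv => hg v (Finset.mem_filter.1 hv).2] at h₃
  rw [← h₂, h₃, add_comm] at h₁
  exact add_left_cancel h₁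

/-- The momentum of a single particle, paired with a space-time vector. -/
noncomputable def minkVar (m : ℝ) (x : Config k r) (v : Var k r) (z : ℝ × ℝ) : ℝ :=
  mink (m * Real.cosh (x v), m * Real.sinh (x v)) z

theorem mink_momentum (m : ℝ) (x : Config k r) (X : Finset (Var k r)) (z : ℝ × ℝ) :
    mink (momentum m x X) z = ∑ v ∈ X, minkVar m x v z := by
  simp only [mink, momentum, minkVar, Prod.fst_sum, Prod.snd_sum, Finset.sum_mul,
    Finset.sum_sub_distrib]

theorem minkVar_sub (m : ℝ) (x : Config k r) (v : Var k r) (z z' : ℝ × ℝ) :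
    minkVar m x v (z - z') = minkVar m x v z - minkVar m x v z' := by
  simp only [minkVar, mink, Prod.fst_sub, Prod.snd_sub]; ring

/-- The total phase, as a sum over the variables. -/
theorem totalP_eq_sum (hr : r 0 = 0) (hk : 1 ≤ k) (m : ℝ) (x : Config k r)
    (y : Fin k → ℝ × ℝ) :
    totalP m x y = ∑ v : Var k r, ((if (v.1 : ℕ) < k then minkVar m x v (pt y (v.1 + 1)) else 0) -
      minkVar m x v (pt y v.1)) := by
  have h₀ : (setA 0 : Finset (Var k r)) = ∅ := by
    ext v
    have := one_le_level hr v
    simp only [mem_setA, Finset.notMem_empty, iff_false]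
    omega
  have hmaps : ∀ v ∈ (Finset.univ : Finset (Var k r)), (v.1 : ℕ) ∈ Finset.Icc 1 k := fun v _ =>
    Finset.mem_Icc.2 ⟨one_le_level hr v, level_le v⟩
  rw [← Finset.sum_fiberwise_of_maps_to hmaps]
  obtain ⟨n, rfl⟩ : ∃ n, k = n + 1 := ⟨k - 1, by omega⟩
  rw [Finset.sum_Icc_succ_top (by omega)]
  simp only [totalP, mink_momentum, h₀, Finset.sum_empty, zero_add, Nat.add_sub_cancel]
  rw [sub_eq_add_neg, ← Finset.sum_neg_distrib]
  congr 1
  · refine Finset.sum_congr rfl fun p hp => Finset.sum_congr rfl fun v hv => ?_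
    have := mem_setA.1 hv
    have := Finset.mem_Icc.1 hp
    rw [minkVar_sub, if_pos (by omega), mem_setA.1 hv]
  · refine Finset.sum_congr rfl fun v hv => ?_
    have := mem_setA.1 hv
    rw [if_neg (by omega), this, zero_sub]

theorem IsCompatible.refinedP_eq_sum (hr : r 0 = 0) (hf : IsLink f) (hc : IsCompatible c f)
    (m : ℝ) (x : Config k r) (y : Fin k → ℝ × ℝ) :
    refinedP m c x y =
      ∑ v : Var k r, ((if (v.1 : ℕ) < k ∧ f v = v then minkVar m x v (pt y (v.1 + 1)) else 0) -
        (if f v = v then minkVar m x v (pt y (c v).1) else 0)) := by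
  have e₁ : ∑ u ∈ Finset.Icc 1 k, ∑ s ∈ Finset.Icc 1 (u - 1),
      mink (momentum m x (blockγ c u s)) (pt y u - pt y s) = ∑ v : Var k r,
        if (v.1 : ℕ) < k ∧ f v = v then minkVar m x v (pt y (v.1 + 1) - pt y (c v).1) else 0 := by
    have : ∀ u s, mink (momentum m x (blockγ c u s)) (pt y u - pt y s) = ∑ v : Var k r,
        if v ∈ blockγ c u s then minkVar m x v (pt y u - pt y s) else 0 := by
      intro u s
      rw [mink_momentum, Finset.sum_ite_mem, Finset.univ_inter]
    simp only [this]
    rw [Finset.sum_congr rfl fun u _ => Finset.sum_comm, Finset.sum_comm]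
    refine Finset.sum_congr rfl fun v _ => ?_
    have h₁ := hc.start_le hf v
    have h₂ := hc.one_le_start hr hf v
    simp only [← hc.flag]
    by_cases hfl : (c v).2 = true
    · have h₃ := ((hc.flag v).1 hfl).1
      rw [Finset.sum_eq_single ((v.1 : ℕ) + 1), Finset.sum_eq_single ((c v).1 : ℕ)]
      · rw [if_pos (mem_blockγ.2 ⟨rfl, rfl, hfl⟩), if_pos hfl]
      · intro s _ hs
        exact if_neg fun h => hs (mem_blockγ.1 h).2.1.symm
      · intro h
        exact absurd (Finset.mem_Icc.2 ⟨h₂, h₁⟩) h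
      · intro u hu hne
        refine Finset.sum_eq_zero fun s _ => if_neg fun h => ?_
        have := (mem_blockγ.1 h).1
        have := (Finset.mem_Icc.1 hu).1
        omega
      · intro h
        exact absurd (Finset.mem_Icc.2 ⟨by omega, by omega⟩) h
    · rw [if_neg hfl]
      exact Finset.sum_eq_zero fun u _ => Finset.sum_eq_zero fun s _ =>
        if_neg fun h => hfl (mem_blockγ.1 h).2.2
  have e₂ : ∑ s ∈ Finset.Icc 1 k, mink (momentum m x (blockB c s)) (pt y s) = ∑ v : Var k r,
      if (v.1 : ℕ) = k then minkVar m x v (pt y (c v).1) else 0 := by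
    have : ∀ s, mink (momentum m x (blockB c s)) (pt y s) = ∑ v : Var k r,
        if v ∈ blockB c s then minkVar m x v (pt y s) else 0 := by
      intro s
      rw [mink_momentum, Finset.sum_ite_mem, Finset.univ_inter]
    simp only [this]
    rw [Finset.sum_comm]
    refine Finset.sum_congr rfl fun v _ => ?_
    have h₁ := hc.start_le hf v
    have h₂ := hc.one_le_start hr hf v
    by_cases hv : (v.1 : ℕ) = k
    · rw [Finset.sum_eq_single ((c v).1 : ℕ)]
      · rw [if_pos hv, if_pos]
        exact mem_blockA.2 ⟨hv, rfl, (hc.flag_eq_false v).2 (by omega)⟩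
      · intro s _ hs
        exact if_neg fun h => hs (mem_blockA.1 h).2.1.symm
      · intro h
        exact absurd (Finset.mem_Icc.2 ⟨h₂, by omega⟩) h
    · rw [if_neg hv]
      exact Finset.sum_eq_zero fun s _ => if_neg fun h => hv (mem_blockA.1 h).1
  rw [refinedP, e₁, e₂, ← Finset.sum_sub_distrib]
  refine Finset.sum_congr rfl fun v _ => ?_
  have h₁ := level_le v
  by_cases hv : (v.1 : ℕ) = k
  · simp [hv, hf.apply_eq_self hv]
  · by_cases hfv : f v = v
    · simp [hv, hfv, lt_of_le_of_ne h₁ hv, minkVar_sub]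
    · simp [hv, hfv]

/-- The phases agree where tied variables coincide: along a chain that starts at level `s` and ends
at level `p`, the differences `y_{q+1} - y_q` add up to `y_{p+1} - y_s`. -/
theorem IsCompatible.totalP_eq_refinedP (hr : r 0 = 0) (hk : 1 ≤ k) (hf : IsLink f)
    (hc : IsCompatible c f) {x : Config k r} (hx : ∀ v, x (f v) = x v) (m : ℝ)
    (y : Fin k → ℝ × ℝ) : totalP m x y = refinedP m c x y := by
  have hμ : ∀ v z, minkVar m x (f v) z = minkVar m x v z := by
    intro v z
    simp only [minkVar, hx]
  rw [totalP_eq_sum hr hk, hc.refinedP_eq_sum hr hf, ← sub_eq_zero, ← Finset.sum_sub_distrib]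
  have e : ∀ v : Var k r,
      ((if (v.1 : ℕ) < k then minkVar m x v (pt y (v.1 + 1)) else 0) - minkVar m x v (pt y v.1)) -
      ((if (v.1 : ℕ) < k ∧ f v = v then minkVar m x v (pt y (v.1 + 1)) else 0) -
        (if f v = v then minkVar m x v (pt y (c v).1) else 0)) =
      (if ¬ f v = v then minkVar m x (f v) (pt y (f v).1) else 0) - minkVar m x v (pt y v.1) +
        (if f v = v then minkVar m x v (pt y (c v).1) else 0) := by
    intro v
    by_cases hfv : f v = v
    · simp only [hfv, and_true, not_true_eq_false, if_true, if_false]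
      ring
    · have h₁ := hf.level v hfv
      have h₂ := level_le (f v)
      simp [hfv, h₁, show (v.1 : ℕ) < k by omega, hμ]
  rw [Finset.sum_congr rfl fun v _ => e v, Finset.sum_add_distrib, Finset.sum_sub_distrib,
    ← Finset.sum_filter, ← Finset.sum_filter,
    sum_apply_eq_sum_image hf fun v => minkVar m x v (pt y v.1),
    sum_chainEnds_eq_sum_chainStarts hf (g := fun v => minkVar m x v (pt y (c v).1))
      (fun v hv => by rw [hμ, hc.next v hv]),
    ← Finset.sum_filter_add_sum_filter_not Finset.univ (fun w => ∃ v, f v ≠ v ∧ f v = w)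
      (fun v => minkVar m x v (pt y v.1)), sub_add_eq_sub_sub, sub_self, zero_sub, neg_add_eq_zero]
  refine Finset.sum_congr rfl fun w hw => ?_
  have := (Finset.mem_filter.1 hw).2
  rw [hc.start w fun v hv hvw => this ⟨v, hv, hvw⟩]

end Chains

/-! ### Reference orders of the chains -/

section Coefficients

variable {k : ℕ} {r : ℕ → ℕ} {f : Var k r → Var k r} {c : Blocks k r} {τ : OuterPerms c}
  {b : ℝ} {x : Config k r} {v w : Var k r}

theorem vecB_perm (τ : OuterPerms c) (s : ℕ) : (vecB c τ s).Perm (vec (blockB c s)) := by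
  unfold vecB
  split_ifs
  · exact permute_perm _ _
  · exact List.Perm.refl _

theorem mem_vecB {s : ℕ} : w ∈ vecB c τ s ↔ w ∈ blockB c s := by
  rw [(vecB_perm τ s).mem_iff, mem_vec]

theorem nodup_vecB (τ : OuterPerms c) (s : ℕ) : (vecB c τ s).Nodup :=
  (vecB_perm τ s).nodup_iff.2 (nodup_vec _)

theorem mem_vecγ {u s : ℕ} : w ∈ vecγ c u s ↔ w ∈ blockγ c u s := mem_vec

/-- The vector `B_s ∪ γ^{(k s)} ∪ … ∪ γ^{(p+1 s)}` of the last variables of the chains that start at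
level `s` and are present at level `p`. -/
noncomputable def aliveFrom (c : Blocks k r) (τ : OuterPerms c) (p s : ℕ) : List (Var k r) :=
  vecB c τ s ++ (List.range (k - p)).reverse.flatMap (fun j => vecγ c (p + 1 + j) s)

/-- The reference order of the chains present at level `p`. -/
noncomputable def aliveOrd (c : Blocks k r) (τ : OuterPerms c) (p : ℕ) : List (Var k r) :=
  (List.range p).flatMap (fun s => aliveFrom c τ p (s + 1))

/-- The reference order of the chains present at levels `p` and `p + 1`. -/
noncomputable def contOrd (c : Blocks k r) (τ : OuterPerms c) (p : ℕ) : List (Var k r) :=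
  (List.range p).flatMap (fun s => aliveFrom c τ (p + 1) (s + 1))

/-- The reference order of the chains that end at level `p`. -/
noncomputable def endOrd (c : Blocks k r) (p : ℕ) : List (Var k r) :=
  (List.range p).flatMap (fun s => vecγ c (p + 1) (s + 1))

theorem reverse_endOrd (c : Blocks k r) (p : ℕ) : (endOrd c p).reverse = leftArg c (p + 1) := by
  rw [endOrd, leftArg, List.reverse_flatMap]
  rfl

theorem aliveOrd_succ (p : ℕ) :
    aliveOrd c τ (p + 1) = contOrd c τ p ++ rightArg c τ (p + 1) := by
  rw [aliveOrd, contOrd, List.range_succ, List.flatMap_append, List.flatMap_singleton]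
  rfl

theorem aliveFrom_eq_append {p : ℕ} (hp : p < k) (s : ℕ) :
    aliveFrom c τ p s = aliveFrom c τ (p + 1) s ++ vecγ c (p + 1) s := by
  obtain ⟨n, hn⟩ : ∃ n, k - p = n + 1 := ⟨k - p - 1, by omega⟩
  have hn' : k - (p + 1) = n := by omega
  rw [aliveFrom, aliveFrom, hn, hn', List.range_succ_eq_map, List.reverse_cons,
    List.flatMap_append, ← List.map_reverse, List.flatMap_map, List.flatMap_singleton,
    List.append_assoc, Nat.add_zero]
  simp only [Nat.succ_eq_add_one, Nat.add_comm _ 1, Nat.add_left_comm, Nat.add_assoc]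

/-- The last variables of the chains present at level `p`, in the order of level `p`. -/
noncomputable def levelEnds (f : Var k r → Var k r) (p : ℕ) : List (Var k r) :=
  (vec (setA p)).map (chainEnd f)

/-- The last variables of the chains present at levels `p` and `p + 1`, in the order of level
`p`. -/
noncomputable def contEnds (f : Var k r → Var k r) (p : ℕ) : List (Var k r) :=
  (vec (contA f p)).map (chainEnd f)

/-- The last variables of the chains that start at level `p + 1`, in the order of that level. -/
noncomputable def newEnds (f : Var k r → Var k r) (p : ℕ) : List (Var k r) :=
  (vec (setA (p + 1) \ (contA f p).image f)).map (chainEnd f)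

theorem nodup_map_chainEnd (hf : IsLink f) {X : Finset (Var k r)} {p : ℕ} (hX : X ⊆ setA p) :
    ((vec X).map (chainEnd f)).Nodup := by
  refine List.Nodup.map_on (fun u hu v hv h => ?_) (nodup_vec X)
  rw [mem_vec] at hu hv
  exact hf.eq_of_chainEnd_eq
    ((mem_setA.1 (hX hu)).trans (mem_setA.1 (hX hv)).symm) h

theorem contA_subset (p : ℕ) : contA f p ⊆ setA p := Finset.filter_subset _ _

theorem IsLink.image_contA_subset (hf : IsLink f) (p : ℕ) :
    (contA f p).image f ⊆ setA (p + 1) := by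
  intro w hw
  obtain ⟨v, hv, rfl⟩ := Finset.mem_image.1 hw
  rw [mem_contA] at hv
  rw [mem_setA, hf.level v hv.2, hv.1]

theorem mem_levelEnds (hf : IsLink f) (hc : IsCompatible c f) {p : ℕ} :
    w ∈ levelEnds f p ↔ f w = w ∧ ((c w).1 : ℕ) ≤ p ∧ p ≤ w.1 := by
  simp only [levelEnds, List.mem_map, mem_vec, mem_setA]
  constructor
  · rintro ⟨v, rfl, rfl⟩
    refine ⟨hf.apply_chainEnd v, ?_, hf.level_le_level_chainEnd v⟩
    rw [hc.start_chainEnd]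
    exact hc.start_le hf v
  · rintro ⟨h₁, h₂, h₃⟩
    obtain ⟨v, hv, hvw⟩ := hc.exists_level_eq hf w h₂ h₃
    exact ⟨v, hv, hvw.trans (IsLink.chainEnd_eq_self h₁)⟩

theorem mem_contEnds (hf : IsLink f) (hc : IsCompatible c f) {p : ℕ} :
    w ∈ contEnds f p ↔ f w = w ∧ ((c w).1 : ℕ) ≤ p ∧ p < w.1 := by
  simp only [contEnds, List.mem_map, mem_vec, mem_contA]
  constructor
  · rintro ⟨v, ⟨rfl, h⟩, rfl⟩
    refine ⟨hf.apply_chainEnd v, ?_, hf.level_lt_level_chainEnd h⟩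
    rw [hc.start_chainEnd]
    exact hc.start_le hf v
  · rintro ⟨h₁, h₂, h₃⟩
    obtain ⟨v, hv, hvw⟩ := hc.exists_level_eq hf w h₂ h₃.le
    rw [IsLink.chainEnd_eq_self h₁] at hvw
    refine ⟨v, ⟨hv, fun h => ?_⟩, hvw⟩
    rw [IsLink.chainEnd_eq_self h] at hvw
    subst hvw
    omega

theorem mem_newEnds (hf : IsLink f) (hc : IsCompatible c f) {p : ℕ} :
    w ∈ newEnds f p ↔ f w = w ∧ ((c w).1 : ℕ) = p + 1 := by
  have key : ∀ v, v ∈ setA (p + 1) \ (contA f p).image f ↔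
      (v.1 : ℕ) = p + 1 ∧ ((c v).1 : ℕ) = p + 1 := by
    intro v
    have h₁ := hc.start_le hf v
    have h₂ := hc.start_lt_iff hf v
    simp only [Finset.mem_sdiff, mem_setA, Finset.mem_image, mem_contA]
    constructor
    · rintro ⟨h₃, h₄⟩
      refine ⟨h₃, ?_⟩
      by_contra hne
      obtain ⟨u, hu, rfl⟩ := h₂.1 (by omega)
      have := hf.level u hu
      exact h₄ ⟨u, ⟨by omega, hu⟩, rfl⟩
    · rintro ⟨h₃, h₄⟩
      refine ⟨h₃, ?_⟩
      rintro ⟨u, ⟨-, hu⟩, rfl⟩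
      have := h₂.2 ⟨u, hu, rfl⟩
      omega
  simp only [newEnds, List.mem_map, mem_vec, key]
  constructor
  · rintro ⟨v, ⟨-, h⟩, rfl⟩
    exact ⟨hf.apply_chainEnd v, by rw [hc.start_chainEnd, h]⟩
  · rintro ⟨h₁, h₂⟩
    obtain ⟨v, hv, hvw⟩ := hc.exists_level_eq (q := p + 1) hf w h₂.le
      (h₂ ▸ hc.start_le hf w)
    rw [IsLink.chainEnd_eq_self h₁] at hvw
    refine ⟨v, ⟨hv, ?_⟩, hvw⟩
    rw [← hc.start_chainEnd, hvw, h₂]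

theorem mem_aliveFrom (hf : IsLink f) (hc : IsCompatible c f) {p s : ℕ} (hp : p ≤ k) :
    w ∈ aliveFrom c τ p s ↔ f w = w ∧ ((c w).1 : ℕ) = s ∧ p ≤ w.1 := by
  have hk := level_le w
  have h₀ : (w.1 : ℕ) = k → f w = w := hf.apply_eq_self
  simp only [aliveFrom, List.mem_append, mem_vecB, blockB, mem_blockA, List.mem_flatMap,
    List.mem_reverse, List.mem_range, mem_vecγ, mem_blockγ, hc.flag, hc.flag_eq_false]
  constructor
  · rintro (⟨h₁, h₂, -⟩ | ⟨j, hj, h₁, h₂, h₃, h₄⟩)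
    · exact ⟨h₀ h₁, h₂, by omega⟩
    · exact ⟨h₄, h₂, by omega⟩
  · rintro ⟨h₁, h₂, h₃⟩
    by_cases h : (w.1 : ℕ) = k
    · exact Or.inl ⟨h, h₂, by omega⟩
    · exact Or.inr ⟨w.1 - p, by omega, by omega, h₂, by omega, h₁⟩

theorem nodup_aliveFrom {p : ℕ} (s : ℕ) : (aliveFrom c τ p s).Nodup := by
  rw [aliveFrom, List.nodup_append']
  refine ⟨nodup_vecB τ s, ?_, ?_⟩
  · rw [List.nodup_flatMap]
    refine ⟨fun j _ => nodup_vec _, ?_⟩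
    refine List.Pairwise.imp ?_ (List.nodup_reverse.2 List.nodup_range)
    intro i j hij v hv hv'
    have h₁ := (mem_blockγ.1 (mem_vec.1 hv)).1
    have h₂ := (mem_blockγ.1 (mem_vec.1 hv')).1
    omega
  · intro v hv hv'
    obtain ⟨j, -, hj⟩ := List.mem_flatMap.1 hv'
    have h₁ := (mem_blockA.1 (mem_vecB.1 hv)).2.2
    have h₂ := (mem_blockγ.1 (mem_vecγ.1 hj)).2.2
    rw [h₁] at h₂
    exact absurd h₂ (by simp)

theorem nodup_flatMap_aliveFrom (hf : IsLink f) (hc : IsCompatible c f) {p : ℕ} (hp : p ≤ k)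
    (n : ℕ) :
    ((List.range n).flatMap (fun s => aliveFrom c τ p (s + 1))).Nodup := by
  rw [List.nodup_flatMap]
  refine ⟨fun s _ => nodup_aliveFrom _, ?_⟩
  refine List.Pairwise.imp ?_ List.nodup_range
  intro s t hst v hv hv'
  have h₁ := ((mem_aliveFrom hf hc hp).1 hv).2.1
  have h₂ := ((mem_aliveFrom hf hc hp).1 hv').2.1
  omega

theorem nodup_endOrd (p : ℕ) : (endOrd c p).Nodup := by
  rw [endOrd, List.nodup_flatMap]
  refine ⟨fun s _ => nodup_vec _, ?_⟩
  refine List.Pairwise.imp ?_ List.nodup_range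
  intro s t hst v hv hv'
  have h₁ := (mem_blockγ.1 (mem_vec.1 hv)).2.1
  have h₂ := (mem_blockγ.1 (mem_vec.1 hv')).2.1
  omega

theorem levelEnds_perm_aliveOrd (hr : r 0 = 0) (hf : IsLink f) (hc : IsCompatible c f)
    {p : ℕ} (hp : p ≤ k) : (levelEnds f p).Perm (aliveOrd c τ p) := by
  refine perm_of_mem_iff (nodup_map_chainEnd hf subset_rfl) (nodup_flatMap_aliveFrom hf hc hp _)
    fun w => ?_
  have h₁ := hc.one_le_start hr hf w
  simp only [aliveOrd, mem_levelEnds hf hc, List.mem_flatMap, List.mem_range,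
    mem_aliveFrom hf hc hp]
  constructor
  · rintro ⟨h₂, h₃, h₄⟩
    exact ⟨(c w).1 - 1, by omega, h₂, by omega, h₄⟩
  · rintro ⟨s, hs, h₂, h₃, h₄⟩
    exact ⟨h₂, by omega, h₄⟩

theorem contEnds_perm_contOrd (hr : r 0 = 0) (hf : IsLink f) (hc : IsCompatible c f)
    {p : ℕ} (hp : p < k) : (contEnds f p).Perm (contOrd c τ p) := by
  refine perm_of_mem_iff (nodup_map_chainEnd hf (contA_subset p))
    (nodup_flatMap_aliveFrom hf hc hp _) fun w => ?_
  have h₁ := hc.one_le_start hr hf w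
  simp only [contOrd, mem_contEnds hf hc, List.mem_flatMap, List.mem_range,
    mem_aliveFrom hf hc (Nat.succ_le_of_lt hp)]
  constructor
  · rintro ⟨h₂, h₃, h₄⟩
    exact ⟨(c w).1 - 1, by omega, h₂, by omega, h₄⟩
  · rintro ⟨s, hs, h₂, h₃, h₄⟩
    exact ⟨h₂, by omega, h₄⟩

theorem endOrd_perm (hr : r 0 = 0) (hf : IsLink f) (hc : IsCompatible c f)
    {p : ℕ} (hp : p < k) : (endOrd c p).Perm (vec (setA p \ contA f p)) := by
  refine perm_of_mem_iff (nodup_endOrd p) (nodup_vec _) fun w => ?_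
  have h₁ := hc.one_le_start hr hf w
  have h₂ := hc.start_le hf w
  simp only [endOrd, List.mem_flatMap, List.mem_range, mem_vecγ, mem_blockγ, hc.flag, mem_vec,
    Finset.mem_sdiff, mem_setA, mem_contA]
  constructor
  · rintro ⟨s, hs, h₃, h₄, h₅, h₆⟩
    exact ⟨by omega, fun h => h.2 h₆⟩
  · rintro ⟨h₃, h₄⟩
    exact ⟨(c w).1 - 1, by omega, by omega, by omega, by omega, by tauto⟩

theorem newEnds_perm_rightArg (hf : IsLink f) (hc : IsCompatible c f) {p : ℕ} (hp : p < k) :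
    (newEnds f p).Perm (rightArg c τ (p + 1)) := by
  refine perm_of_mem_iff (nodup_map_chainEnd hf Finset.sdiff_subset) (nodup_aliveFrom _)
    fun w => ?_
  have h₂ := hc.start_le hf w
  rw [show rightArg c τ (p + 1) = aliveFrom c τ (p + 1) (p + 1) from rfl, mem_newEnds hf hc,
    mem_aliveFrom hf hc (Nat.succ_le_of_lt hp)]
  constructor
  · rintro ⟨h₃, h₄⟩; exact ⟨h₃, h₄, by omega⟩
  · rintro ⟨h₃, h₄, -⟩; exact ⟨h₃, h₄⟩

end Coefficients

/-! ### Comparison of the coefficients -/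

section Telescoping

variable {k : ℕ} {r : ℕ → ℕ} {f : Var k r → Var k r} {c : Blocks k r} {τ : OuterPerms c}
  {b : ℝ} {x : Config k r}

theorem crossS_flatMap_left {ι : Type*} (l : List ι) (h : ι → List (Var k r))
    (M : List (Var k r)) :
    crossS b x (l.flatMap h) M = (l.map fun i => crossS b x (h i) M).prod := by
  induction l with
  | nil => simp [crossS_nil_left]
  | cons i l ih => rw [List.flatMap_cons, crossS_append_left, ih, List.map_cons, List.prod_cons]

theorem crossS_flatMap_range_right (L : List (Var k r)) (h : ℕ → List (Var k r)) (n : ℕ) :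
    crossS b x L ((List.range n).flatMap h) = ∏ s ∈ Finset.range n, crossS b x L (h s) := by
  induction n with
  | zero => simp [crossS_nil_right]
  | succ n ih =>
    rw [List.range_succ, List.flatMap_append, List.flatMap_singleton, crossS_append_right, ih,
      Finset.prod_range_succ]

/-- Moving the blocks `g s` of an alternating concatenation behind all the blocks `E u` exchanges
`E u` and `g s` for `s < u`. -/
theorem permS_flatMap_interleave (E g : ℕ → List (Var k r)) (n : ℕ)
    (h : ((List.range n).flatMap E ++ (List.range n).flatMap g).Nodup) :
    permS b x ((List.range n).flatMap E ++ (List.range n).flatMap g)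
        ((List.range n).flatMap fun s => E s ++ g s) =
      ∏ u ∈ Finset.range n, ∏ s ∈ Finset.range u, crossS b x (E u) (g s) := by
  induction n with
  | zero => simp [permS_nil]
  | succ n ih =>
    simp only [List.range_succ, List.flatMap_append, List.flatMap_singleton] at h ⊢
    set E' := (List.range n).flatMap E
    set g' := (List.range n).flatMap g
    have hp : (E' ++ g').Perm ((List.range n).flatMap fun s => E s ++ g s) :=
      List.flatMap_append_perm _ _ _
    -- the middle blocks `E n` and `g'` are exchanged first
    have hmid : (E' ++ E n ++ (g' ++ g n)).Perm ((E' ++ g') ++ (E n ++ g n)) := by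
      simp only [List.append_assoc]
      refine List.Perm.append_left _ ?_
      simp only [← List.append_assoc]
      exact List.Perm.append_right _ List.perm_append_comm
    have hnd := hmid.nodup_iff.1 h
    have hnd' : (E' ++ ((E n ++ g') ++ g n)).Nodup := by simpa [List.append_assoc] using h
    have e₁ : permS b x (E' ++ E n ++ (g' ++ g n)) ((E' ++ g') ++ (E n ++ g n)) =
        crossS b x (E n) g' := by
      have : permS b x (E' ++ ((E n ++ g') ++ g n)) (E' ++ ((g' ++ E n) ++ g n)) =
          crossS b x (E n) g' := by
        rw [permS_append_left hnd' (List.Perm.append_right _ List.perm_append_comm),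
          permS_append_right (List.Nodup.of_append_right hnd') List.perm_append_comm,
          permS_append_comm (List.Nodup.of_append_left (List.Nodup.of_append_right hnd'))]
      simpa [List.append_assoc] using this
    rw [← permS_trans h hmid (List.Perm.append_right _ hp), e₁, permS_append_right hnd hp,
      ih (List.Nodup.of_append_left hnd), Finset.prod_range_succ, crossS_flatMap_range_right,
      mul_comm]

theorem levelEnds_last (hf : IsLink f) : levelEnds f k = vec (setA k) := by
  rw [levelEnds, List.map_congr_left (g := id), List.map_id]
  intro v hv
  exact IsLink.chainEnd_eq_self (hf.apply_eq_self (mem_setA.1 (mem_vec.1 hv)))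

theorem aliveOrd_last : aliveOrd c τ k = (List.range k).flatMap (fun s => vecB c τ (s + 1)) := by
  simp [aliveOrd, aliveFrom]

theorem levelEnds_zero (hr : r 0 = 0) : levelEnds f 0 = ([] : List (Var k r)) := by
  have h₀ : (setA 0 : Finset (Var k r)) = ∅ := by
    ext v
    have := one_le_level hr v
    simp only [mem_setA, Finset.notMem_empty, iff_false]
    omega
  rw [levelEnds, h₀, vec_empty, List.map_nil]

theorem map_chainEnd_vec_sdiff_contA (p : ℕ) :
    (vec (setA p \ contA f p)).map (chainEnd f) = vec (setA p \ contA f p) := by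
  conv_rhs => rw [← List.map_id (vec (setA p \ contA f p))]
  refine List.map_congr_left fun v hv => ?_
  rw [mem_vec, Finset.mem_sdiff, mem_setA, mem_contA] at hv
  exact IsLink.chainEnd_eq_self (by tauto)

theorem vec_append_vec_sdiff_perm {X Y : Finset (Var k r)} (h : Y ⊆ X) :
    (vec Y ++ vec (X \ Y)).Perm (vec X) := by
  refine perm_of_mem_iff ?_ (nodup_vec _) fun w => ?_
  · refine List.Nodup.append (nodup_vec _) (nodup_vec _) fun v hv hv' => ?_
    exact (Finset.mem_sdiff.1 (mem_vec.1 hv')).2 (mem_vec.1 hv)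
  · simp only [List.mem_append, mem_vec, Finset.mem_sdiff]
    constructor
    · rintro (h₁ | h₁)
      · exact h h₁
      · exact h₁.1
    · intro h₁
      by_cases h₂ : w ∈ Y
      · exact Or.inl h₂
      · exact Or.inr ⟨h₁, h₂⟩

theorem map_vec_contA_perm (hf : IsLink f) (p : ℕ) :
    ((vec (contA f p)).map f).Perm (vec ((contA f p).image f)) := by
  refine perm_of_mem_iff ?_ (nodup_vec _) fun w => by simp [mem_vec]
  exact List.Nodup.map_on (fun u hu v hv h => hf.injOn_contA p (by simpa [mem_vec] using hu)
    (by simpa [mem_vec] using hv) h) (nodup_vec _)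

/-- The factor of the kernel of level `p + 1` attached to the family of matchings `f`. -/
noncomputable def kernelCoeff (b : ℝ) (F : (n : ℕ) → (Fin n → ℂ) → ℂ) (ε : ℝ)
    (f : Var k r → Var k r) (x : Config k r) (p : ℕ) : ℂ :=
  permS b x (vec (setA p)).reverse
      ((vec (setA p \ contA f p)).reverse ++ (vec (contA f p)).reverse) *
    permS b x (vec (setA (p + 1)))
      ((vec (contA f p)).map f ++ vec (setA (p + 1) \ (contA f p).image f)) *
    evalF F (shiftedArg ε x (vec (setA p \ contA f p)).reverse ++
      realArg x (vec (setA (p + 1) \ (contA f p).image f)))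

/-- One step of the telescoping: at each level the actual order of the chains is compared with the
reference order, and the chains ending at level `p` are moved behind those that continue. -/
theorem kernelCoeff_eq (hr : r 0 = 0) (hf : IsLink f) (hc : IsCompatible c f)
    (hx : ∀ v, x (f v) = x v) {ω w : ℝ} {s : ℂ} {F : (n : ℕ) → (Fin n → ℂ) → ℂ}
    (hF : IsFormFactor b ω s w F) {ε : ℝ} (hε : 0 < ε ∧ ε < Real.pi) {p : ℕ} (hp : p < k) :
    kernelCoeff b F ε f x p =
      permS b x (levelEnds f (p + 1)) (aliveOrd c τ (p + 1)) *
        permS b x (aliveOrd c τ p) (levelEnds f p) *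
        permS b x (contOrd c τ p ++ endOrd c p) (aliveOrd c τ p) *
        evalF F (shiftedArg ε x (leftArg c (p + 1)) ++ realArg x (rightArg c τ (p + 1))) := by
  have hxe := comp_chainEnd hx
  have hinj : ∀ q, ∀ u ∈ vec (setA q), ∀ v ∈ vec (setA q), chainEnd f u = chainEnd f v → u = v :=
    fun q u hu v hv h => hf.eq_of_chainEnd_eq
      ((mem_setA.1 (mem_vec.1 hu)).trans (mem_setA.1 (mem_vec.1 hv)).symm) h
  set Γ := vec (setA p \ contA f p)
  have hCC : (contEnds f p).Perm (contOrd c τ p) := contEnds_perm_contOrd hr hf hc hp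
  have hgΓ : (endOrd c p).Perm Γ := endOrd_perm hr hf hc hp
  have hNR : (newEnds f p).Perm (rightArg c τ (p + 1)) := newEnds_perm_rightArg hf hc hp
  have hW : (levelEnds f p).Perm (aliveOrd c τ p) := levelEnds_perm_aliveOrd hr hf hc hp.le
  have hndW : (levelEnds f p).Nodup := nodup_map_chainEnd hf subset_rfl
  have hndW' : (levelEnds f (p + 1)).Nodup := nodup_map_chainEnd hf subset_rfl
  -- the level `p`
  have hP₁ : (vec (contA f p) ++ Γ).Perm (vec (setA p)) :=
    vec_append_vec_sdiff_perm (contA_subset p)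
  have hP₁' : (contEnds f p ++ Γ).Perm (levelEnds f p) := by
    have := hP₁.map (chainEnd f)
    rwa [List.map_append, map_chainEnd_vec_sdiff_contA] at this
  have e₁ : permS b x (vec (setA p)).reverse (Γ.reverse ++ (vec (contA f p)).reverse) =
      permS b x (contEnds f p ++ Γ) (levelEnds f p) := by
    rw [← List.reverse_append, permS_reverse, ← permS_map hxe _ hP₁, List.map_append,
      map_chainEnd_vec_sdiff_contA]
    · rfl
    · exact fun u hu v hv h => hinj p u (hP₁.subset hu) v (hP₁.subset hv) h
  -- the level `p + 1`
  have hP₂ : ((vec (contA f p)).map f ++ vec (setA (p + 1) \ (contA f p).image f)).Perm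
      (vec (setA (p + 1))) :=
    ((map_vec_contA_perm hf p).append_right _).trans
      (vec_append_vec_sdiff_perm (hf.image_contA_subset p))
  have hmap : ((vec (contA f p)).map f ++ vec (setA (p + 1) \ (contA f p).image f)).map
      (chainEnd f) = contEnds f p ++ newEnds f p := by
    rw [List.map_append, List.map_map]
    congr 1
    exact List.map_congr_left fun v _ => hf.chainEnd_apply v
  have hP₂' : (levelEnds f (p + 1)).Perm (contEnds f p ++ newEnds f p) := by
    have := (hP₂.map (chainEnd f)).symm
    rwa [hmap] at this
  have e₂ : permS b x (vec (setA (p + 1)))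
      ((vec (contA f p)).map f ++ vec (setA (p + 1) \ (contA f p).image f)) =
      permS b x (levelEnds f (p + 1)) (contEnds f p ++ newEnds f p) := by
    rw [← permS_map hxe (hinj (p + 1)) hP₂.symm, hmap]
    rfl
  -- the arguments of the form factor
  have e₃ : realArg x (vec (setA (p + 1) \ (contA f p).image f)) = realArg x (newEnds f p) := by
    rw [newEnds, realArg, realArg, List.map_map]
    exact List.map_congr_left fun v _ => by simp [hxe]
  have e₄ : evalF F (shiftedArg ε x Γ.reverse ++ realArg x (newEnds f p)) =
      permS b x (endOrd c p) Γ * permS b x (newEnds f p) (rightArg c τ (p + 1)) *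
      evalF F (shiftedArg ε x (leftArg c (p + 1)) ++ realArg x (rightArg c τ (p + 1))) := by
    rw [hF.evalF_reorder hε x (List.nodup_reverse.2 (nodup_vec _))
      ((List.reverse_perm Γ).trans (hgΓ.symm.trans (List.reverse_perm _).symm))
      (List.Nodup.of_append_right (hP₂'.nodup_iff.1 hndW')) hNR, permS_reverse, reverse_endOrd]
  -- the comparison of the orders
  have hnd₁ := hP₁'.nodup_iff.2 hndW
  have hCg : (contEnds f p ++ endOrd c p).Perm (contEnds f p ++ Γ) := hgΓ.append_left _
  have hCg' : (contEnds f p ++ endOrd c p).Perm (contOrd c τ p ++ endOrd c p) :=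
    hCC.append_right _
  have hndCg := hCg.nodup_iff.2 hnd₁
  have hX : (contOrd c τ p ++ endOrd c p).Perm (aliveOrd c τ p) :=
    hCg'.symm.trans (hCg.trans (hP₁'.trans hW))
  have f₁ : permS b x (endOrd c p) Γ * permS b x (contEnds f p ++ Γ) (levelEnds f p) =
      permS b x (contEnds f p) (contOrd c τ p) *
        (permS b x (contOrd c τ p ++ endOrd c p) (aliveOrd c τ p) *
          permS b x (aliveOrd c τ p) (levelEnds f p)) := by
    rw [permS_trans (hCg'.nodup_iff.1 hndCg) hX hW.symm, ← permS_append_left hndCg hgΓ,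
      permS_trans hndCg hCg hP₁', ← permS_append_right hndCg hCC,
      permS_trans hndCg hCg' (hX.trans hW.symm)]
  have hCN : (contEnds f p ++ newEnds f p).Perm (contEnds f p ++ rightArg c τ (p + 1)) :=
    hNR.append_left _
  have hCR : (contOrd c τ p ++ rightArg c τ (p + 1)).Perm
      (contEnds f p ++ rightArg c τ (p + 1)) := hCC.symm.append_right _
  have hndCN := hP₂'.nodup_iff.1 hndW'
  have hndCR := hCR.nodup_iff.2 (hCN.nodup_iff.1 hndCN)
  have f₂ : permS b x (levelEnds f (p + 1)) (contEnds f p ++ newEnds f p) *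
        permS b x (newEnds f p) (rightArg c τ (p + 1)) =
      permS b x (levelEnds f (p + 1)) (aliveOrd c τ (p + 1)) *
        permS b x (contOrd c τ p) (contEnds f p) := by
    rw [aliveOrd_succ, ← permS_append_left hndCN hNR, permS_trans hndW' hP₂' hCN,
      ← permS_append_right hndCR hCC.symm,
      permS_trans hndW' ((hP₂'.trans hCN).trans hCR.symm) hCR]
  have f₃ : permS b x (contEnds f p) (contOrd c τ p) * permS b x (contOrd c τ p) (contEnds f p) =
      1 := permS_mul_symm (List.Nodup.of_append_left hndCN) hCC
  rw [kernelCoeff, e₁, e₂, e₃, e₄]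
  -- the two comparisons of `contEnds` with `contOrd`, from `f₁` and `f₂`, cancel by `f₃`
  linear_combination
    (permS b x (levelEnds f (p + 1)) (contEnds f p ++ newEnds f p) *
      permS b x (newEnds f p) (rightArg c τ (p + 1)) *
      evalF F (shiftedArg ε x (leftArg c (p + 1)) ++ realArg x (rightArg c τ (p + 1)))) * f₁ +
    (permS b x (contEnds f p) (contOrd c τ p) *
        (permS b x (contOrd c τ p ++ endOrd c p) (aliveOrd c τ p) *
          permS b x (aliveOrd c τ p) (levelEnds f p)) *
      evalF F (shiftedArg ε x (leftArg c (p + 1)) ++ realArg x (rightArg c τ (p + 1)))) * f₂ +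
    (permS b x (levelEnds f (p + 1)) (aliveOrd c τ (p + 1)) *
        permS b x (aliveOrd c τ p) (levelEnds f p) *
        permS b x (contOrd c τ p ++ endOrd c p) (aliveOrd c τ p) *
        evalF F (shiftedArg ε x (leftArg c (p + 1)) ++ realArg x (rightArg c τ (p + 1)))) * f₃

theorem permS_contOrd_append_endOrd (hr : r 0 = 0) (hf : IsLink f) (hc : IsCompatible c f) {p : ℕ}
    (hp : p < k) :
    permS b x (contOrd c τ p ++ endOrd c p) (aliveOrd c τ p) =
      ∏ u ∈ Finset.range p, ∏ s ∈ Finset.range u,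
        crossS b x (aliveFrom c τ (p + 1) (u + 1)) (vecγ c (p + 1) (s + 1)) := by
  have e : aliveOrd c τ p = (List.range p).flatMap
      fun s => aliveFrom c τ (p + 1) (s + 1) ++ vecγ c (p + 1) (s + 1) := by
    simp only [aliveOrd, aliveFrom_eq_append hp]
  have hperm : (contOrd c τ p ++ endOrd c p).Perm (aliveOrd c τ p) := by
    rw [e]; exact List.flatMap_append_perm _ _ _
  rw [e]
  exact permS_flatMap_interleave _ _ p
    (hperm.nodup_iff.2 ((levelEnds_perm_aliveOrd hr hf hc hp.le).nodup_iff.1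
      (nodup_map_chainEnd hf subset_rfl)))

theorem prod_range_add_one {M : Type*} [CommMonoid M] (h : ℕ → M) (n : ℕ) :
    ∏ i ∈ Finset.range n, h (i + 1) = ∏ i ∈ Finset.Icc 1 n, h i := by
  rw [Finset.range_eq_Ico, Finset.prod_Ico_add' h 0 n 1]
  rfl

theorem crossS_aliveFrom {p : ℕ} (u : ℕ) (M : List (Var k r)) :
    crossS b x (aliveFrom c τ p u) M =
      crossS b x (vecB c τ u) M * ∏ v ∈ Finset.Icc (p + 1) k, crossS b x (vecγ c v u) M := by
  rw [aliveFrom, crossS_append_left, crossS_flatMap_left, List.map_reverse, List.prod_reverse,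
    ← List.prod_toFinset _ List.nodup_range, List.toFinset_range,
    show Finset.Icc (p + 1) k = Finset.Ico (p + 1) (k + 1) from rfl,
    Finset.prod_Ico_eq_prod_range, Nat.add_sub_add_right]

theorem permS_vecB_append_vecγ {p : ℕ} (hp : p < k) (u s : ℕ) :
    permS b x (vecB c τ u ++ vecγ c (p + 1) s) (vecγ c (p + 1) s ++ vecB c τ u) =
      crossS b x (vecB c τ u) (vecγ c (p + 1) s) := by
  refine permS_append_comm (List.Nodup.append (nodup_vecB τ u) (nodup_vec _) fun v hv hv' => ?_)
  have h₁ := (mem_blockA.1 (mem_vecB.1 hv)).1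
  have h₂ := (mem_blockγ.1 (mem_vecγ.1 hv')).1
  omega

theorem permS_vecγ_append_vecγ {p v : ℕ} (hp : 1 ≤ p) (hv : p < v) (u s : ℕ) :
    permS b x (vecγ c v u ++ vecγ c p s) (vecγ c p s ++ vecγ c v u) =
      crossS b x (vecγ c v u) (vecγ c p s) := by
  refine permS_append_comm (List.Nodup.append (nodup_vec _) (nodup_vec _) fun w hw hw' => ?_)
  have h₁ := (mem_blockγ.1 (mem_vecγ.1 hw)).1
  have h₂ := (mem_blockγ.1 (mem_vecγ.1 hw')).1
  omega

/-- The products of S-matrices over pairs of blocks collect the exchanges needed, level by level, to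
move the chains that end behind those that continue. -/
theorem prod_permS_contOrd_append_endOrd (hr : r 0 = 0) (hf : IsLink f) (hc : IsCompatible c f) :
    ∏ p ∈ Finset.range k, permS b x (contOrd c τ p ++ endOrd c p) (aliveOrd c τ p) =
      (∏ p ∈ Finset.Icc 2 (k - 1), ∏ s ∈ Finset.Icc 1 (p - 1), ∏ v ∈ Finset.Icc (s + 1) p,
        permS b x (vecB c τ v ++ vecγ c (p + 1) s) (vecγ c (p + 1) s ++ vecB c τ v)) *
      ∏ p ∈ Finset.Icc 3 k, ∏ v ∈ Finset.Icc (p + 1) k,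
        ∏ u ∈ Finset.Icc 1 (p - 1), ∏ s ∈ Finset.Icc 1 (u - 1),
          permS b x (vecγ c v u ++ vecγ c p s) (vecγ c p s ++ vecγ c v u) := by
  have e : ∀ p ∈ Finset.range k,
      permS b x (contOrd c τ p ++ endOrd c p) (aliveOrd c τ p) =
      (∏ u ∈ Finset.Icc 1 p, ∏ s ∈ Finset.Icc 1 (u - 1),
        crossS b x (vecB c τ u) (vecγ c (p + 1) s)) *
      ∏ u ∈ Finset.Icc 1 p, ∏ s ∈ Finset.Icc 1 (u - 1), ∏ v ∈ Finset.Icc (p + 1 + 1) k,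
        crossS b x (vecγ c v u) (vecγ c (p + 1) s) := by
    intro p hp
    rw [permS_contOrd_append_endOrd hr hf hc (Finset.mem_range.1 hp), ← Finset.prod_mul_distrib,
      ← prod_range_add_one]
    refine Finset.prod_congr rfl fun u _ => ?_
    rw [← Finset.prod_mul_distrib, Nat.add_sub_cancel, ← prod_range_add_one]
    exact Finset.prod_congr rfl fun s _ => crossS_aliveFrom _ _
  rw [Finset.prod_congr rfl e, Finset.prod_mul_distrib]
  congr 1
  · have hsub : Finset.Icc 2 (k - 1) ⊆ Finset.range k := by
      intro p hp
      rw [Finset.mem_Icc] at hp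
      rw [Finset.mem_range]
      omega
    rw [← Finset.prod_subset hsub]
    · refine Finset.prod_congr rfl fun p hp => ?_
      have hpk := Finset.mem_range.1 (hsub hp)
      rw [Finset.prod_comm' (t' := Finset.Icc 1 (p - 1)) (s' := fun s => Finset.Icc (s + 1) p)]
      · exact Finset.prod_congr rfl fun s _ => Finset.prod_congr rfl fun v _ =>
          (permS_vecB_append_vecγ hpk v s).symm
      · intro u s
        simp only [Finset.mem_Icc]
        omega
    · intro p hp hp'
      rw [Finset.mem_range] at hp
      rw [Finset.mem_Icc] at hp'
      refine Finset.prod_eq_one fun u hu => ?_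
      rw [Finset.mem_Icc] at hu
      rw [Finset.Icc_eq_empty (by omega), Finset.prod_empty]
  · refine (prod_range_add_one (fun p => ∏ u ∈ Finset.Icc 1 (p - 1), ∏ s ∈ Finset.Icc 1 (u - 1),
      ∏ v ∈ Finset.Icc (p + 1) k, crossS b x (vecγ c v u) (vecγ c p s)) k).trans ?_
    have hsub : Finset.Icc 3 k ⊆ Finset.Icc 1 k := Finset.Icc_subset_Icc (by omega) le_rfl
    rw [← Finset.prod_subset hsub]
    · refine Finset.prod_congr rfl fun p hp => ?_
      rw [Finset.prod_congr rfl fun u _ => Finset.prod_comm, Finset.prod_comm]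
      rw [Finset.mem_Icc] at hp
      refine Finset.prod_congr rfl fun v hv => ?_
      rw [Finset.mem_Icc] at hv
      exact Finset.prod_congr rfl fun u _ => Finset.prod_congr rfl fun s _ =>
          (permS_vecγ_append_vecγ (by omega) (by omega) u s).symm
    · intro p hp hp'
      rw [Finset.mem_Icc] at hp hp'
      refine Finset.prod_eq_one fun u hu => ?_
      rw [Finset.mem_Icc] at hu
      rw [Finset.Icc_eq_empty (by omega), Finset.prod_empty]

/-- The coefficients of the two generalised functions agree where tied variables coincide. -/
theorem prod_kernelCoeff_eq (hr : r 0 = 0) (hf : IsLink f) (hc : IsCompatible c f)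
    (hx : ∀ v, x (f v) = x v) {ω : ℕ → ℝ} {spin : ℕ → ℂ} {w : ℕ → ℝ}
    {F : ℕ → (n : ℕ) → (Fin n → ℂ) → ℂ} {ε : ℕ → ℝ}
    (hF : ∀ p ∈ Finset.Icc 1 k, IsFormFactor b (ω p) (spin p) (w p) (F p))
    (hε : ∀ p ∈ Finset.Icc 1 k, 0 < ε p ∧ ε p < Real.pi) :
    ∏ p ∈ Finset.range k, kernelCoeff b (F (p + 1)) (ε (p + 1)) f x p =
      refinedS b c τ x * refinedF F ε c τ x := by
  have hmem : ∀ p ∈ Finset.range k, p + 1 ∈ Finset.Icc 1 k := by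
    intro p hp
    rw [Finset.mem_range] at hp
    rw [Finset.mem_Icc]
    omega
  have htel : ∀ n ≤ k, ∏ p ∈ Finset.range n,
      (permS b x (levelEnds f (p + 1)) (aliveOrd c τ (p + 1)) *
        permS b x (aliveOrd c τ p) (levelEnds f p)) =
      permS b x (levelEnds f n) (aliveOrd c τ n) := by
    intro n
    induction n with
    | zero =>
      intro _
      rw [levelEnds_zero hr, Finset.prod_range_zero]
      simp [aliveOrd, permS_nil]
    | succ n ih =>
      intro hn
      rw [Finset.prod_range_succ, ih (by omega), mul_left_comm, permS_mul_symm, mul_one]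
      · exact nodup_map_chainEnd hf subset_rfl
      · exact levelEnds_perm_aliveOrd hr hf hc (by omega)
  rw [Finset.prod_congr rfl fun p hp => kernelCoeff_eq (τ := τ) hr hf hc hx (hF _ (hmem p hp))
      (hε _ (hmem p hp)) (Finset.mem_range.1 hp),
    Finset.prod_mul_distrib, Finset.prod_mul_distrib, htel k le_rfl,
    prod_permS_contOrd_append_endOrd hr hf hc, levelEnds_last hf, aliveOrd_last,
    prod_range_add_one fun p => evalF (F p) (shiftedArg (ε p) x (leftArg c p) ++
      realArg x (rightArg c τ p)), refinedS, refinedF]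
  ring

end Telescoping

/-! ### The product of kernels as a sum over families of matchings -/

section KernelSum

variable {k : ℕ} {r : ℕ → ℕ} {f g : Var k r → Var k r}

/-- The map that sends the entries of the vector `X` to those of the vector `L` of the same length,
and fixes all other variables. -/
def matchFn (X L : List (Var k r)) (v : Var k r) : Var k r :=
  if v ∈ X then (L[X.idxOf v]?).getD v else v

theorem matchFn_of_notMem {X L : List (Var k r)} {v : Var k r} (h : v ∉ X) : matchFn X L v = v :=
  if_neg h

theorem map_matchFn {X L : List (Var k r)} (hX : X.Nodup) (h : L.length = X.length) :
    X.map (matchFn X L) = L := by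
  refine List.ext_getElem (by simp [h]) fun n h₁ h₂ => ?_
  rw [List.getElem_map, matchFn, if_pos (List.getElem_mem _), hX.idxOf_getElem,
    List.getElem?_eq_getElem h₂]
  rfl

open Classical in
/-- The matchings between the levels `p` and `p + 1`. -/
noncomputable def localLinks (k : ℕ) (r : ℕ → ℕ) (p : ℕ) : Finset (Var k r → Var k r) :=
  Finset.univ.filter fun g =>
    (∀ v, g v ≠ v → (v.1 : ℕ) = p ∧ ((g v).1 : ℕ) = p + 1) ∧
      ∀ v w, g v ≠ v → g w ≠ w → g v = g w → v = w

open Classical in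
/-- The families of matchings between consecutive levels. -/
noncomputable def links (k : ℕ) (r : ℕ → ℕ) : Finset (Var k r → Var k r) :=
  Finset.univ.filter IsLink

theorem mem_localLinks {p : ℕ} : g ∈ localLinks k r p ↔
    (∀ v, g v ≠ v → (v.1 : ℕ) = p ∧ ((g v).1 : ℕ) = p + 1) ∧
      ∀ v w, g v ≠ v → g w ≠ w → g v = g w → v = w := by
  simp [localLinks]

theorem mem_links : f ∈ links k r ↔ IsLink f := by simp [links]

theorem toFinset_map_vec (X : Finset (Var k r)) (g : Var k r → Var k r) :
    ((vec X).map g).toFinset = X.image g := by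
  ext v; simp [mem_vec]

/-- A partition `A^{(p)} = A₁ ∪ A₂`, `A^{(p+1)} = B₁ ∪ B₂` with a labelling of `B₁` is the same as a
matching between the two levels. -/
theorem sum_partitions_eq_sum_localLinks {M : Type*} [AddCommMonoid M] (p : ℕ)
    (H : Finset (Var k r) → Finset (Var k r) → List (Var k r) → M) :
    ∑ A ∈ (setA p : Finset (Var k r)).powerset,
      ∑ B ∈ (setA (p + 1) : Finset (Var k r)).powersetCard A.card,
        ∑ σ : Equiv.Perm (Fin (vec B).length), H A B (permute (vec B) σ) =
    ∑ g ∈ localLinks k r p, H (contA g p) ((contA g p).image g) ((vec (contA g p)).map g) := by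
  simp only [Finset.sum_sigma']
  have key : ∀ (A B : Finset (Var k r)) (σ : Equiv.Perm (Fin (vec B).length)),
      A ⊆ setA p → B ⊆ setA (p + 1) → B.card = A.card →
      let g := matchFn (vec A) (permute (vec B) σ)
      g ∈ localLinks k r p ∧ contA g p = A ∧ A.image g = B ∧
        (vec A).map g = permute (vec B) σ := by
    intro A B σ hA hB hAB g
    have hmap : (vec A).map g = permute (vec B) σ := by
      refine map_matchFn (nodup_vec A) ?_
      rw [(permute_perm _ σ).length_eq, length_vec, length_vec, hAB]
    have himg : A.image g = B := by
      rw [← toFinset_map_vec, hmap, List.toFinset_eq_of_perm _ _ (permute_perm _ σ), toFinset_vec]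
    have hmem : ∀ v ∈ A, ((g v).1 : ℕ) = p + 1 := fun v hv =>
      mem_setA.1 (hB (himg ▸ Finset.mem_image_of_mem g hv))
    have hmoved : ∀ v, g v ≠ v ↔ v ∈ A := by
      intro v
      constructor
      · intro h
        by_contra hv
        exact h (matchFn_of_notMem (by rwa [mem_vec]))
      · intro hv h
        have h₁ := hmem v hv
        have h₂ := mem_setA.1 (hA hv)
        rw [h] at h₁
        omega
    refine ⟨mem_localLinks.2 ⟨fun v hv => ?_, fun v w hv hw h => ?_⟩, ?_, himg, hmap⟩
    · rw [hmoved] at hv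
      exact ⟨mem_setA.1 (hA hv), hmem v hv⟩
    · rw [hmoved] at hv hw
      refine List.inj_on_of_nodup_map (f := g) (l := vec A) ?_ (mem_vec.2 hv) (mem_vec.2 hw) h
      rw [hmap]
      exact (permute_perm _ σ).nodup_iff.2 (nodup_vec B)
    · ext v
      rw [mem_contA, hmoved]
      exact ⟨fun h => h.2, fun h => ⟨mem_setA.1 (hA h), h⟩⟩
  have key' : ∀ y ∈ (setA p : Finset (Var k r)).powerset.sigma fun A =>
      ((setA (p + 1) : Finset (Var k r)).powersetCard A.card).sigma fun B =>
        (Finset.univ : Finset (Equiv.Perm (Fin (vec B).length))),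
      y.1 ⊆ setA p ∧ y.2.1 ⊆ setA (p + 1) ∧ y.2.1.card = y.1.card := by
    intro y hy
    rw [Finset.mem_sigma, Finset.mem_sigma, Finset.mem_powerset, Finset.mem_powersetCard] at hy
    exact ⟨hy.1, hy.2.1.1, hy.2.1.2⟩
  refine Finset.sum_bij (fun y _ => matchFn (vec y.1) (permute (vec y.2.1) y.2.2)) ?_ ?_ ?_ ?_
  · intro y hy
    obtain ⟨h₁, h₂, h₃⟩ := key' y hy
    exact (key _ _ _ h₁ h₂ h₃).1
  · rintro ⟨A, B, σ⟩ hy ⟨A', B', σ'⟩ hy' h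
    obtain ⟨h₁, h₂, h₃⟩ := key' _ hy
    obtain ⟨h₁', h₂', h₃'⟩ := key' _ hy'
    obtain ⟨-, e₁, e₂, e₃⟩ := key _ _ σ h₁ h₂ h₃
    obtain ⟨-, e₁', e₂', e₃'⟩ := key _ _ σ' h₁' h₂' h₃'
    simp only at h
    rw [h] at e₁ e₂ e₃
    obtain rfl : A = A' := e₁.symm.trans e₁'
    obtain rfl : B = B' := e₂.symm.trans e₂'
    obtain rfl : σ = σ' := permute_injective (nodup_vec B) (e₃.symm.trans e₃')
    rfl
  · intro g hg
    rw [mem_localLinks] at hg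
    have hinj : Set.InjOn g (contA g p) := fun v hv w hw h =>
      hg.2 v w (mem_contA.1 hv).2 (mem_contA.1 hw).2 h
    have hperm : ((vec (contA g p)).map g).Perm (vec ((contA g p).image g)) := by
      refine perm_of_mem_iff ?_ (nodup_vec _) fun w => by simp [mem_vec]
      exact List.Nodup.map_on (fun u hu v hv h => hinj (by simpa [mem_vec] using hu)
        (by simpa [mem_vec] using hv) h) (nodup_vec _)
    obtain ⟨σ, hσ⟩ := exists_permute_eq (nodup_vec _) hperm
    have hB : (contA g p).image g ⊆ setA (p + 1) := by
      intro w hw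
      obtain ⟨v, hv, rfl⟩ := Finset.mem_image.1 hw
      exact mem_setA.2 (hg.1 v (mem_contA.1 hv).2).2
    have hcard := Finset.card_image_of_injOn hinj
    refine ⟨⟨contA g p, (contA g p).image g, σ⟩, ?_, ?_⟩
    · rw [Finset.mem_sigma, Finset.mem_sigma, Finset.mem_powerset, Finset.mem_powersetCard]
      exact ⟨contA_subset p, ⟨hB, hcard⟩, Finset.mem_univ _⟩
    · have e := (key _ _ σ (contA_subset p) hB hcard).2.2.2
      rw [hσ] at e
      funext v
      by_cases hv : v ∈ contA g p
      · exact List.map_inj_left.1 (by rw [hσ]; exact e) v (mem_vec.2 hv)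
      · have : g v = v := by
          by_contra h
          exact hv (mem_contA.2 ⟨(hg.1 v h).1, h⟩)
        rw [this]
        exact matchFn_of_notMem (by rwa [mem_vec])
  · intro y hy
    obtain ⟨h₁, h₂, h₃⟩ := key' y hy
    obtain ⟨-, e₁, e₂, e₃⟩ := key _ _ y.2.2 h₁ h₂ h₃
    simp only [e₁, e₂, e₃]

/-- Matchings may be chosen independently at each level. -/
theorem prod_sum_localLinks {M : Type*} [CommSemiring M] (H : ℕ → (Var k r → Var k r) → M)
    (hH : ∀ p f g, (∀ v ∈ (setA p : Finset (Var k r)), f v = g v) → H p f = H p g) :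
    ∏ p ∈ Finset.range k, ∑ g ∈ localLinks k r p, H p g =
      ∑ f ∈ links k r, ∏ p ∈ Finset.range k, H p f := by
  simp only [Finset.prod_range]
  rw [Finset.prod_univ_sum]
  let glue : (Fin k → Var k r → Var k r) → Var k r → Var k r := fun G v =>
    if h : (v.1 : ℕ) < k then G ⟨v.1, h⟩ v else v
  let cut : (Var k r → Var k r) → Fin k → Var k r → Var k r := fun f i v =>
    if (v.1 : ℕ) = i then f v else v
  have hcut : ∀ (f : Var k r → Var k r) (i : Fin k) v, cut f i v ≠ v →
      (v.1 : ℕ) = i ∧ cut f i v = f v ∧ f v ≠ v := by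
    intro f i v h
    by_cases hv : (v.1 : ℕ) = i
    · have e : cut f i v = f v := if_pos hv
      exact ⟨hv, e, e ▸ h⟩
    · exact absurd (if_neg hv) h
  have hglue : ∀ (G : Fin k → Var k r → Var k r) v, glue G v ≠ v →
      ∃ i : Fin k, (v.1 : ℕ) = i ∧ glue G v = G i v ∧ G i v ≠ v := by
    intro G v h
    by_cases hv : (v.1 : ℕ) < k
    · have e : glue G v = G ⟨v.1, hv⟩ v := dif_pos hv
      exact ⟨⟨v.1, hv⟩, rfl, e, e ▸ h⟩
    · exact absurd (dif_neg hv) h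
  refine Finset.sum_bij' (fun G _ => glue G) (fun f _ => cut f) ?_ ?_ ?_ ?_ ?_
  · intro G hG
    rw [Fintype.mem_piFinset] at hG
    refine mem_links.2 ⟨fun v hv => ?_, fun v w hv hw h => ?_⟩
    · obtain ⟨i, h₁, h₂, h₃⟩ := hglue G v hv
      have := (mem_localLinks.1 (hG i)).1 v h₃
      rw [h₂, this.2, this.1]
    · obtain ⟨i, h₁, h₂, h₃⟩ := hglue G v hv
      obtain ⟨j, h₁', h₂', h₃'⟩ := hglue G w hw
      have e₁ := ((mem_localLinks.1 (hG i)).1 v h₃).2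
      have e₂ := ((mem_localLinks.1 (hG j)).1 w h₃').2
      rw [h₂, h₂'] at h
      rw [h, e₂] at e₁
      obtain rfl : i = j := Fin.ext (by omega)
      exact (mem_localLinks.1 (hG i)).2 v w h₃ h₃' h
  · intro f hf
    rw [mem_links] at hf
    rw [Fintype.mem_piFinset]
    intro i
    refine mem_localLinks.2 ⟨fun v hv => ?_, fun v w hv hw h => ?_⟩
    · obtain ⟨h₁, h₂, h₃⟩ := hcut f i v hv
      exact ⟨h₁, by rw [h₂, hf.level v h₃, h₁]⟩
    · obtain ⟨h₁, h₂, h₃⟩ := hcut f i v hv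
      obtain ⟨h₁', h₂', h₃'⟩ := hcut f i w hw
      exact hf.inj v w h₃ h₃' (by rw [← h₂, ← h₂', h])
  · intro G hG
    rw [Fintype.mem_piFinset] at hG
    funext i v
    by_cases hv : (v.1 : ℕ) = i
    · have e : (⟨(v.1 : ℕ), hv ▸ i.2⟩ : Fin k) = i := Fin.ext hv
      simp only [cut, glue, if_pos hv, dif_pos (hv ▸ i.2 : (v.1 : ℕ) < k), e]
    · simp only [cut, if_neg hv]
      by_contra h
      exact hv ((mem_localLinks.1 (hG i)).1 v (Ne.symm h)).1
  · intro f hf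
    rw [mem_links] at hf
    funext v
    by_cases hv : (v.1 : ℕ) < k
    · simp [glue, cut, hv]
    · simp only [glue, dif_neg hv]
      exact (hf.apply_eq_self (by have := level_le v; omega)).symm
  · intro G hG
    refine Finset.prod_congr rfl fun i _ => hH _ _ _ fun v hv => ?_
    have hv := mem_setA.1 hv
    have e : (⟨(v.1 : ℕ), hv ▸ i.2⟩ : Fin k) = i := Fin.ext hv
    simp only [glue, dif_pos (hv ▸ i.2 : (v.1 : ℕ) < k), e]

/-- The Dirac mass `2π δ(x_u - x_v)`. -/
noncomputable def tie (u v : Var k r) : GenFun k r :=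
  ofFun (fun _ => 2 * Real.pi) * MvPolynomial.X (u, v)

theorem Delta_map (X : Finset (Var k r)) (f : Var k r → Var k r) :
    Delta (vec X) ((vec X).map f) = ∏ v ∈ X, tie v (f v) := by
  have h : ∀ L : List (Var k r), Delta L (L.map f) = (L.map fun v => tie v (f v)).prod := by
    intro L
    rw [Delta, List.zip_map_right, List.map_map]
    congr 1
    induction L with
    | nil => rfl
    | cons a L ih => simp only [List.zip_cons_cons, List.map_cons, ih]; rfl
  rw [h, ← List.prod_toFinset _ (nodup_vec X), toFinset_vec]

/-- The Dirac masses of all ties of `f`. -/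
noncomputable def ties (f : Var k r → Var k r) : GenFun k r :=
  ∏ v ∈ Finset.univ.filter (fun v => f v ≠ v), tie v (f v)

theorem IsLink.prod_Delta_contA (hf : IsLink f) :
    ∏ p ∈ Finset.range k, Delta (vec (contA f p)) ((vec (contA f p)).map f) = ties f := by
  have hmaps : ∀ v ∈ Finset.univ.filter (fun v => f v ≠ v), (v.1 : ℕ) ∈ Finset.range k := by
    intro v hv
    have h₁ := hf.level v (Finset.mem_filter.1 hv).2
    have h₂ := level_le (f v)
    rw [Finset.mem_range]
    omega
  rw [ties, ← Finset.prod_fiberwise_of_maps_to hmaps]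
  refine Finset.prod_congr rfl fun p _ => ?_
  rw [Delta_map]
  refine Finset.prod_congr ?_ fun _ _ => rfl
  ext v
  simp only [mem_contA, Finset.mem_filter, Finset.mem_univ, true_and, and_comm]

theorem restrict_ties_eq_zero {x : Config k r} (h : ¬ ∀ v, x (f v) = x v) :
    restrict x (ties f) = 0 := by
  push Not at h
  obtain ⟨v, hv⟩ := h
  have hfv : f v ≠ v := fun h => hv (by rw [h])
  rw [ties, map_prod]
  refine Finset.prod_eq_zero (Finset.mem_filter.2 ⟨Finset.mem_univ v, hfv⟩) ?_
  rw [tie, map_mul, restrict_X, if_neg (Ne.symm hv), mul_zero]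

theorem ofFun_mul (h h' : Config k r → ℂ) : ofFun (fun x => h x * h' x) = ofFun h * ofFun h' :=
  map_mul MvPolynomial.C h h'

theorem ofFun_prod {ι : Type*} (s : Finset ι) (h : ι → Config k r → ℂ) :
    ∏ i ∈ s, ofFun (h i) = ofFun fun x => ∏ i ∈ s, h i x := by
  have := map_prod (MvPolynomial.C (σ := Var k r × Var k r) (R := Config k r → ℂ)) h s
  rw [ofFun, ← Finset.prod_fn, this]
  rfl

theorem kernel_succ (b : ℝ) (ω : ℕ → ℝ) (F : ℕ → (n : ℕ) → (Fin n → ℂ) → ℂ) (ε : ℕ → ℝ) (p : ℕ) :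
    (kernel b ω F ε (p + 1) : GenFun k r) = ofFun (fun _ => phase r ω (p + 1)) *
      ∑ g ∈ localLinks k r p, Delta (vec (contA g p)) ((vec (contA g p)).map g) *
        ofFun fun x => kernelCoeff b (F (p + 1)) (ε (p + 1)) g x p := by
  rw [kernel, Nat.add_sub_cancel]
  congr 1
  exact sum_partitions_eq_sum_localLinks p fun A B L => Delta (vec A) L *
    ofFun (fun x => permS b x (vec (setA p)).reverse ((vec (setA p \ A)).reverse ++
      (vec A).reverse) * permS b x (vec (setA (p + 1))) (L ++ vec (setA (p + 1) \ B)) *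
      evalF (F (p + 1)) (shiftedArg (ε (p + 1)) x (vec (setA p \ A)).reverse ++
        realArg x (vec (setA (p + 1) \ B))))

theorem Gtot_eq_sum_links (b m : ℝ) (ω : ℕ → ℝ) (F : ℕ → (n : ℕ) → (Fin n → ℂ) → ℂ) (ε : ℕ → ℝ)
    (G : 𝓢(Fin k → ℝ × ℝ, ℂ)) :
    (Gtot b m ω F ε G : GenFun k r) = ofFun (fun _ => ∏ s ∈ Finset.Icc 1 k, phase r ω s) *
      ∑ f ∈ links k r, ties f * ofFun fun x =>
        (∏ p ∈ Finset.range k, kernelCoeff b (F (p + 1)) (ε (p + 1)) f x p) * totalR m G x := by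
  have hH : ∀ p (f g : Var k r → Var k r), (∀ v ∈ (setA p : Finset (Var k r)), f v = g v) →
      Delta (vec (contA f p)) ((vec (contA f p)).map f) *
        ofFun (fun x => kernelCoeff b (F (p + 1)) (ε (p + 1)) f x p) =
      Delta (vec (contA g p)) ((vec (contA g p)).map g) *
        ofFun (fun x => kernelCoeff b (F (p + 1)) (ε (p + 1)) g x p) := by
    intro p f g h
    have e₁ : contA f p = contA g p :=
      Finset.filter_congr fun v hv => by rw [h v hv]
    have e₂ : (vec (contA g p)).map f = (vec (contA g p)).map g :=
      List.map_congr_left fun v hv => h v (contA_subset p (mem_vec.1 hv))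
    have e₃ : (contA g p).image f = (contA g p).image g :=
      Finset.image_congr fun v hv => h v (contA_subset p hv)
    simp only [kernelCoeff, e₁, e₂, e₃]
  rw [Gtot, ← prod_range_add_one fun l => kernel b ω F ε l]
  simp only [kernel_succ]
  rw [Finset.prod_mul_distrib, prod_sum_localLinks _ hH, ofFun_prod]
  simp only [prod_range_add_one fun l => phase r ω l]
  rw [mul_assoc, Finset.sum_mul]
  congr 1
  refine Finset.sum_congr rfl fun f hf => ?_
  rw [Finset.prod_mul_distrib, (mem_links.1 hf).prod_Delta_contA, ofFun_prod, ofFun_mul, mul_assoc]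

end KernelSum

/-! ### The sum over refined partitions as a sum over families of matchings -/

section RefinedSum

variable {k : ℕ} {r : ℕ → ℕ} {f : Var k r → Var k r} {c : Blocks k r}

/-- The vector of level `p + 1` whose entries are tied, in order, to those of the vector
`A_s^{(p)}`. -/
noncomputable def targetVec (c : Blocks k r) (σ : InnerPerms c) (τ : OuterPerms c) (p s : ℕ) :
    List (Var k r) :=
  if h : p + 1 < k ∧ 1 ≤ s ∧ s < p + 1 then
    permute (vec (blockA c (p + 1) s ∪ blockγ c (p + 1 + 1) s))
      (σ ⟨(⟨p + 1, h.1⟩, ⟨s, h.2.2.trans h.1⟩), h.2⟩)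
  else vecB c τ s

/-- The family of matchings determined by a refined partition and by permutations. -/
noncomputable def linkOf (c : Blocks k r) (σ : InnerPerms c) (τ : OuterPerms c) (v : Var k r) :
    Var k r :=
  if (v.1 : ℕ) < k ∧ (c v).2 = false then
    matchFn (vec (blockA c v.1 (c v).1)) (targetVec c σ τ v.1 (c v).1) v
  else v

theorem mem_vec_blockA_self {v : Var k r} (hv : (v.1 : ℕ) < k ∧ (c v).2 = false) :
    v ∈ vec (blockA c v.1 (c v).1) := mem_vec.2 (mem_blockA.2 ⟨rfl, rfl, hv.2⟩)

namespace IsRefined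

theorem blockγ_succ_last (hc : IsRefined c) (s : ℕ) : blockγ c (k + 1) s = ∅ := by
  ext v
  simp only [mem_blockγ, Finset.notMem_empty, iff_false]
  rintro ⟨h₁, -, h₂⟩
  rw [hc.last v (mem_setA.2 h₁)] at h₂
  exact absurd h₂ (by simp)

theorem targetVec_perm (hc : IsRefined c) (σ : InnerPerms c) (τ : OuterPerms c) {p s : ℕ}
    (hp : p < k) (hs : 1 ≤ s) (hsp : s ≤ p) :
    (targetVec c σ τ p s).Perm (vec (blockA c (p + 1) s ∪ blockγ c (p + 1 + 1) s)) := by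
  unfold targetVec
  split_ifs with h
  · exact permute_perm _ _
  · obtain rfl : k = p + 1 := by omega
    rw [hc.blockγ_succ_last, Finset.union_empty]
    exact vecB_perm τ s

theorem card_block_succ (hc : IsRefined c) {p s : ℕ} (hp : p < k) (hs : 1 ≤ s) (hsp : s ≤ p) :
    (blockA c (p + 1) s ∪ blockγ c (p + 1 + 1) s).card = (blockA c p s).card := by
  by_cases h : p + 1 < k
  · exact (hc.card_inner (p + 1) s (by omega) (by omega) hs (by omega)).symm
  · obtain rfl : k = p + 1 := by omega
    rw [hc.blockγ_succ_last, Finset.union_empty]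
    exact (hc.card_outer s hs (by omega)).symm

theorem map_linkOf (hc : IsRefined c) (σ : InnerPerms c) (τ : OuterPerms c) {p s : ℕ}
    (hp : p < k) (hs : 1 ≤ s) (hsp : s ≤ p) :
    (vec (blockA c p s)).map (linkOf c σ τ) = targetVec c σ τ p s := by
  rw [← map_matchFn (nodup_vec (blockA c p s)) (L := targetVec c σ τ p s)]
  · refine List.map_congr_left fun v hv => ?_
    obtain ⟨h₁, h₂, h₃⟩ := mem_blockA.1 (mem_vec.1 hv)
    rw [linkOf, if_pos ⟨by omega, h₃⟩, h₁, h₂]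
  · rw [(hc.targetVec_perm σ τ hp hs hsp).length_eq, length_vec, length_vec,
      hc.card_block_succ hp hs hsp]

theorem linkOf_mem (hc : IsRefined c) (σ : InnerPerms c) (τ : OuterPerms c) {v : Var k r}
    (hv : (v.1 : ℕ) < k ∧ (c v).2 = false) :
    ((linkOf c σ τ v).1 : ℕ) = v.1 + 1 ∧ (c (linkOf c σ τ v)).1 = (c v).1 := by
  have hi := hc.index v
  have h₁ : linkOf c σ τ v ∈ (vec (blockA c v.1 (c v).1)).map (linkOf c σ τ) :=
    List.mem_map_of_mem (mem_vec_blockA_self hv)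
  rw [hc.map_linkOf σ τ hv.1 hi.1 hi.2, (hc.targetVec_perm σ τ hv.1 hi.1 hi.2).mem_iff, mem_vec,
    Finset.mem_union, mem_blockA, mem_blockγ] at h₁
  rcases h₁ with h₁ | h₁
  · exact ⟨h₁.1, Fin.ext h₁.2.1⟩
  · exact ⟨h₁.1, Fin.ext h₁.2.1⟩

theorem linkOf_ne_iff (hc : IsRefined c) (σ : InnerPerms c) (τ : OuterPerms c) (v : Var k r) :
    linkOf c σ τ v ≠ v ↔ (v.1 : ℕ) < k ∧ (c v).2 = false := by
  constructor
  · intro h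
    by_contra hv
    exact h (if_neg hv)
  · intro hv h
    have := (hc.linkOf_mem σ τ hv).1
    rw [h] at this
    omega

theorem isLink_linkOf (hc : IsRefined c) (σ : InnerPerms c) (τ : OuterPerms c) :
    IsLink (linkOf c σ τ) where
  level v hv := (hc.linkOf_mem σ τ ((hc.linkOf_ne_iff σ τ v).1 hv)).1
  inj v w hv hw h := by
    rw [hc.linkOf_ne_iff] at hv hw
    have h₁ := hc.linkOf_mem σ τ hv
    have h₂ := hc.linkOf_mem σ τ hw
    rw [h, h₂.1, h₂.2] at h₁
    have hi := hc.index v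
    have hmem := mem_vec_blockA_self hw
    rw [h₁.2, show (w.1 : ℕ) = v.1 by omega] at hmem
    refine List.inj_on_of_nodup_map ?_ (mem_vec_blockA_self hv) hmem h
    rw [hc.map_linkOf σ τ hv.1 hi.1 hi.2]
    exact (hc.targetVec_perm σ τ hv.1 hi.1 hi.2).nodup_iff.2 (nodup_vec _)

theorem isCompatible_linkOf (hc : IsRefined c) (σ : InnerPerms c) (τ : OuterPerms c) :
    IsCompatible c (linkOf c σ τ) where
  next v hv := (hc.linkOf_mem σ τ ((hc.linkOf_ne_iff σ τ v).1 hv)).2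
  start w hw := by
    have hi := hc.index w
    by_contra hne
    obtain ⟨p, hp⟩ : ∃ p, (w.1 : ℕ) = p + 1 := ⟨w.1 - 1, by omega⟩
    have hk := level_le w
    have hmem : w ∈ targetVec c σ τ p (c w).1 := by
      rw [(hc.targetVec_perm σ τ (by omega) hi.1 (by omega)).mem_iff, mem_vec, Finset.mem_union,
        mem_blockA, mem_blockγ]
      cases h : (c w).2
      · exact Or.inl ⟨hp, rfl, rfl⟩
      · exact Or.inr ⟨hp, rfl, rfl⟩
    rw [← hc.map_linkOf σ τ (by omega) hi.1 (by omega)] at hmem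
    obtain ⟨v, hv, hvw⟩ := List.mem_map.1 hmem
    obtain ⟨h₁, -, h₂⟩ := mem_blockA.1 (mem_vec.1 hv)
    exact hw v ((hc.linkOf_ne_iff σ τ v).2 ⟨by omega, h₂⟩) hvw
  flag v := by
    have h₁ := hc.linkOf_ne_iff σ τ v
    have h₂ := hc.last v
    rw [mem_setA] at h₂
    have h₃ := level_le v
    cases h : (c v).2
    · rw [h] at h₁
      simp only [Bool.false_eq_true, false_iff]
      rintro ⟨h₄, h₅⟩
      exact h₁.2 ⟨h₄, rfl⟩ h₅
    · rw [h] at h₁ h₂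
      simp only [true_iff]
      refine ⟨lt_of_le_of_ne h₃ fun h => by simpa using h₂ h, ?_⟩
      by_contra h₄
      simpa using (h₁.1 h₄).2

theorem linkOf_injective (hc : IsRefined c) {σ σ' : InnerPerms c} {τ τ' : OuterPerms c}
    (h : linkOf c σ τ = linkOf c σ' τ') : σ = σ' ∧ τ = τ' := by
  have key : ∀ p s, p < k → 1 ≤ s → s ≤ p → targetVec c σ τ p s = targetVec c σ' τ' p s := by
    intro p s hp hs hsp
    rw [← hc.map_linkOf σ τ hp hs hsp, ← hc.map_linkOf σ' τ' hp hs hsp, h]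
  constructor
  · funext i
    obtain ⟨⟨⟨p, hp⟩, ⟨s, hs⟩⟩, h₁, h₂⟩ := i
    simp only at h₁ h₂
    obtain ⟨q, rfl⟩ : ∃ q, p = q + 1 := ⟨p - 1, by omega⟩
    have := key q s (by omega) h₁ (by omega)
    rw [targetVec, targetVec, dif_pos ⟨hp, h₁, h₂⟩, dif_pos ⟨hp, h₁, h₂⟩] at this
    exact permute_injective (nodup_vec _) this
  · funext i
    obtain ⟨⟨s, hs⟩, h₁⟩ := i
    simp only at h₁
    have := key (k - 1) s (by omega) h₁ (by omega)
    rw [targetVec, targetVec, dif_neg (by omega), dif_neg (by omega), vecB, vecB,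
      dif_pos ⟨h₁, hs⟩, dif_pos ⟨h₁, hs⟩] at this
    exact permute_injective (nodup_vec _) this

end IsRefined

theorem IsCompatible.map_vec_blockA_perm (hf : IsLink f) (hc : IsCompatible c f) {p s : ℕ}
    (hp : p < k) (hs : s ≤ p) : ((vec (blockA c p s)).map f).Perm
      (vec (blockA c (p + 1) s ∪ blockγ c (p + 2) s)) := by
  rw [← hc.image_blockA hf hp hs]
  refine perm_of_mem_iff ?_ (nodup_vec _) fun w => by simp [mem_vec]
  exact List.Nodup.map_on (fun u hu v hv h => hc.injOn_blockA hf hp (mem_vec.1 hu)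
    (mem_vec.1 hv) h) (nodup_vec _)

theorem IsCompatible.exists_linkOf_eq (hr : r 0 = 0) (hf : IsLink f) (hc : IsCompatible c f) :
    ∃ σ τ, linkOf c σ τ = f := by
  have hR := hc.isRefined hr hf
  have hσ : ∀ i : InnerIdx k, ∃ ρ, permute (vec (blockA c (i.1.1 : ℕ) i.1.2 ∪
      blockγ c ((i.1.1 : ℕ) + 1) i.1.2)) ρ = (vec (blockA c ((i.1.1 : ℕ) - 1) i.1.2)).map f := by
    rintro ⟨⟨⟨p, hp⟩, ⟨s, hs⟩⟩, h₁, h₂⟩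
    simp only at h₁ h₂
    obtain ⟨q, rfl⟩ : ∃ q, p = q + 1 := ⟨p - 1, by omega⟩
    exact exists_permute_eq (nodup_vec _)
      (hc.map_vec_blockA_perm hf (p := q) (s := s) (by omega) (by omega))
  have hτ : ∀ i : OuterIdx k, ∃ ρ, permute (vec (blockB c i.1)) ρ =
      (vec (blockA c (k - 1) i.1)).map f := by
    rintro ⟨⟨s, hs⟩, h₁⟩
    simp only at h₁
    have := hc.map_vec_blockA_perm hf (p := k - 1) (s := s) (by omega) (by omega)
    rw [show k - 1 + 2 = k + 1 by omega, hR.blockγ_succ_last, Finset.union_empty,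
      show k - 1 + 1 = k by omega] at this
    exact exists_permute_eq (nodup_vec _) this
  choose σ hσ using hσ
  choose τ hτ using hτ
  refine ⟨σ, τ, ?_⟩
  have key : ∀ p s, p < k → 1 ≤ s → s ≤ p → targetVec c σ τ p s = (vec (blockA c p s)).map f := by
    intro p s hp hs hsp
    unfold targetVec
    split_ifs with h
    · exact hσ ⟨(⟨p + 1, h.1⟩, ⟨s, h.2.2.trans h.1⟩), h.2⟩
    · rw [vecB, dif_pos ⟨hs, by omega⟩]
      refine (hτ ⟨⟨s, by omega⟩, hs⟩).trans ?_
      simp only [show k - 1 = p by omega]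
  funext v
  have h₁ := hR.linkOf_ne_iff σ τ v
  have h₂ := hc.flag_eq_false v
  by_cases hv : (v.1 : ℕ) < k ∧ (c v).2 = false
  · have hi := hR.index v
    refine List.map_inj_left.1 ?_ v (mem_vec_blockA_self hv)
    rw [hR.map_linkOf σ τ hv.1 hi.1 hi.2, key _ _ hv.1 hi.1 hi.2]
  · have h₃ := level_le v
    have e : f v = v := by
      by_cases hl : (v.1 : ℕ) = k
      · exact hf.apply_eq_self hl
      · by_contra h
        exact hv ⟨by omega, h₂.2 fun _ => h⟩
    rw [e]
    exact not_not.1 fun h => hv (h₁.1 h)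

/-- The Dirac masses of a term of the sum over refined partitions are those of the associated
family of matchings. -/
theorem IsRefined.prod_Delta (hc : IsRefined c) (σ : InnerPerms c) (τ : OuterPerms c) :
    (∏ i : InnerIdx k, Delta (vec (blockA c ((i.1.1 : ℕ) - 1) i.1.2))
        (permute (vec (blockA c (i.1.1 : ℕ) i.1.2 ∪ blockγ c ((i.1.1 : ℕ) + 1) i.1.2)) (σ i))) *
      ∏ i : OuterIdx k, Delta (vec (blockA c (k - 1) i.1)) (vecB c τ i.1) =
    ties (linkOf c σ τ) := by
  have e₁ : ∀ i : InnerIdx k, Delta (vec (blockA c ((i.1.1 : ℕ) - 1) i.1.2))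
      (permute (vec (blockA c (i.1.1 : ℕ) i.1.2 ∪ blockγ c ((i.1.1 : ℕ) + 1) i.1.2)) (σ i)) =
      ∏ v ∈ blockA c ((i.1.1 : ℕ) - 1) i.1.2, tie v (linkOf c σ τ v) := by
    rintro ⟨⟨⟨p, hp⟩, ⟨s, hs⟩⟩, h₁, h₂⟩
    simp only at h₁ h₂
    obtain ⟨q, rfl⟩ : ∃ q, p = q + 1 := ⟨p - 1, by omega⟩
    have := hc.map_linkOf σ τ (p := q) (s := s) (by omega) h₁ (by omega)
    rw [targetVec, dif_pos ⟨hp, h₁, h₂⟩] at this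
    rw [← Delta_map]
    simp only [Nat.add_sub_cancel]
    rw [this]
  have e₂ : ∀ i : OuterIdx k, Delta (vec (blockA c (k - 1) i.1)) (vecB c τ i.1) =
      ∏ v ∈ blockA c (k - 1) i.1, tie v (linkOf c σ τ v) := by
    rintro ⟨⟨s, hs⟩, h₁⟩
    simp only at h₁
    have := hc.map_linkOf σ τ (p := k - 1) (s := s) (by omega) h₁ (by omega)
    rw [targetVec, dif_neg (by omega)] at this
    rw [← Delta_map, this]
  rw [Finset.prod_congr rfl fun i _ => e₁ i, Finset.prod_congr rfl fun i _ => e₂ i,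
    ← Finset.prod_biUnion, ← Finset.prod_biUnion, ← Finset.prod_union]
  · refine Finset.prod_congr ?_ fun _ _ => rfl
    ext v
    have hi := hc.index v
    simp only [Finset.mem_union, Finset.mem_biUnion, Finset.mem_univ, true_and, mem_blockA,
      Finset.mem_filter, hc.linkOf_ne_iff]
    constructor
    · rintro (⟨⟨⟨⟨p, hp⟩, ⟨s, hs⟩⟩, h₁, h₂⟩, h₃, h₄, h₅⟩ | ⟨⟨⟨s, hs⟩, h₁⟩, h₃, h₄, h₅⟩)
      · simp only at h₁ h₂ h₃
        exact ⟨by omega, h₅⟩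
      · simp only at h₁ h₃
        exact ⟨by omega, h₅⟩
    · rintro ⟨h₁, h₂⟩
      by_cases h : (v.1 : ℕ) + 1 < k
      · exact Or.inl ⟨⟨(⟨v.1 + 1, h⟩, ⟨(c v).1, by omega⟩), hi.1, Nat.lt_succ_of_le hi.2⟩,
          by simp, rfl, h₂⟩
      · exact Or.inr ⟨⟨⟨(c v).1, by omega⟩, hi.1⟩, by omega, rfl, h₂⟩
  · rw [Finset.disjoint_left]
    intro v hv hv'
    simp only [Finset.mem_biUnion, Finset.mem_univ, true_and, mem_blockA] at hv hv'
    obtain ⟨⟨⟨⟨p, hp⟩, ⟨s, hs⟩⟩, h₁, h₂⟩, h₃, -⟩ := hv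
    obtain ⟨-, h₄, -⟩ := hv'
    simp only at h₁ h₂ h₃
    omega
  · rintro ⟨⟨s, hs⟩, h₁⟩ - ⟨⟨s', hs'⟩, h₁'⟩ - hne
    rw [Function.onFun, Finset.disjoint_left]
    intro v hv hv'
    have h₂ := (mem_blockA.1 hv).2.1
    have h₃ := (mem_blockA.1 hv').2.1
    apply hne
    simp only [Subtype.mk.injEq, Fin.mk.injEq]
    exact h₂.symm.trans h₃
  · rintro ⟨⟨⟨p, hp⟩, ⟨s, hs⟩⟩, h₁, h₂⟩ - ⟨⟨⟨p', hp'⟩, ⟨s', hs'⟩⟩, h₁', h₂'⟩ - hne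
    rw [Function.onFun, Finset.disjoint_left]
    intro v hv hv'
    have h₃ := mem_blockA.1 hv
    have h₄ := mem_blockA.1 hv'
    simp only at h₁ h₂ h₁' h₂' h₃ h₄
    apply hne
    simp only [Subtype.mk.injEq, Prod.mk.injEq, Fin.mk.injEq]
    omega

/-! ### Equality of the two distributions -/

theorem IsCompatible.totalR_eq_refinedR (hr : r 0 = 0) (hk : 1 ≤ k) (hf : IsLink f)
    (hc : IsCompatible c f) {x : Config k r} (hx : ∀ v, x (f v) = x v) (m : ℝ)
    (G : 𝓢(Fin k → ℝ × ℝ, ℂ)) : totalR m G x = refinedR m G c x := by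
  simp only [totalR, refinedR, hc.totalP_eq_refinedP hr hk hf hx]

theorem restrict_Gtot_eq_restrict_refinedSum {b m : ℝ} (hk : 1 ≤ k) (hr : r 0 = 0) {ω : ℕ → ℝ}
    {spin : ℕ → ℂ} {w : ℕ → ℝ} {F : ℕ → (n : ℕ) → (Fin n → ℂ) → ℂ} {ε : ℕ → ℝ}
    (hF : ∀ p ∈ Finset.Icc 1 k, IsFormFactor b (ω p) (spin p) (w p) (F p))
    (hε : ∀ p ∈ Finset.Icc 1 k, 0 < ε p ∧ ε p < Real.pi) (G : 𝓢(Fin k → ℝ × ℝ, ℂ))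
    (x : Config k r) :
    restrict x (Gtot b m ω F ε G) = restrict x (refinedSum b m ω F ε G) := by
  classical
  rw [Gtot_eq_sum_links, refinedSum, map_mul, map_mul]
  refine congrArg (restrict x _ * ·) ?_
  rw [map_sum]
  simp only [Finset.sum_sigma', map_sum]
  symm
  have hmem : ∀ y ∈ (Finset.univ.filter IsRefined).sigma fun c : Blocks k r =>
      (Finset.univ : Finset (InnerPerms c)).sigma fun _ => (Finset.univ : Finset (OuterPerms c)),
      IsRefined y.1 := fun y hy => (Finset.mem_filter.1 (Finset.mem_sigma.1 hy).1).2
  refine Finset.sum_bij (fun y _ => linkOf y.1 y.2.1 y.2.2) ?_ ?_ ?_ ?_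
  · intro y hy
    exact mem_links.2 ((hmem y hy).isLink_linkOf _ _)
  · rintro ⟨c, σ, τ⟩ hy ⟨c', σ', τ'⟩ hy' h
    have hc := hmem _ hy
    have hc' := hmem _ hy'
    simp only at hc hc' h
    have hcomp := hc'.isCompatible_linkOf σ' τ'
    rw [← h] at hcomp
    obtain rfl : c = c' :=
      (hc.isCompatible_linkOf σ τ).unique (hc.isLink_linkOf σ τ) hcomp
    obtain ⟨rfl, rfl⟩ := hc.linkOf_injective h
    rfl
  · intro f hf
    rw [mem_links] at hf
    obtain ⟨c, hc⟩ := hf.exists_isCompatible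
    obtain ⟨σ, τ, h⟩ := hc.exists_linkOf_eq hr hf
    exact ⟨⟨c, σ, τ⟩, by simpa using hc.isRefined hr hf, h⟩
  · rintro ⟨c, σ, τ⟩ hy
    have hc := hmem _ hy
    simp only at hc ⊢
    have hf := hc.isLink_linkOf σ τ
    have hcomp := hc.isCompatible_linkOf σ τ
    rw [show ∀ A B C D E : GenFun k r, A * B * C * D * E = B * C * (A * D * E) by
      intros; ring, hc.prod_Delta σ τ]
    simp only [map_mul, restrict_ofFun]
    by_cases hx : ∀ v, x (linkOf c σ τ v) = x v
    · rw [prod_kernelCoeff_eq (τ := τ) hr hf hcomp hx hF hε,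
        hcomp.totalR_eq_refinedR hr hk hf hx m G, map_mul]
    · rw [restrict_ties_eq_zero hx, zero_mul, zero_mul]

end RefinedSum

end ShG

theorem mainTheorem5
    (b m : ℝ) (hb : b ∈ Set.Icc (0 : ℝ) (1 / 2)) (hm : 0 < m)
    (k : ℕ) (hk : 1 ≤ k) (r : ℕ → ℕ) (hr : r 0 = 0)
    (ω : ℕ → ℝ) (spin : ℕ → ℂ) (w : ℕ → ℝ) (F : ℕ → (n : ℕ) → (Fin n → ℂ) → ℂ)
    (hF : ∀ p ∈ Finset.Icc 1 k, ShG.IsFormFactor b (ω p) (spin p) (w p) (F p))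
    (ε : ℕ → ℝ) (hε : ∀ p ∈ Finset.Icc 1 k, 0 < ε p ∧ ε p < Real.pi)
    (G : 𝓢(Fin k → ℝ × ℝ, ℂ)) :
    ShG.IsWellDefined (ShG.Gtot b m ω F ε G : ShG.GenFun k r) ∧
    ShG.IsWellDefined (ShG.refinedSum b m ω F ε G : ShG.GenFun k r) ∧
    ∀ φ : ShG.Config k r → ℂ, ContDiff ℝ ((⊤ : ℕ∞) : WithTop ℕ∞) φ → HasCompactSupport φ →
      ShG.pair (ShG.Gtot b m ω F ε G) φ = ShG.pair (ShG.refinedSum b m ω F ε G) φ :=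
  ⟨(ShG.hasContinuousCoeff_Gtot hF hε G).isWellDefined,
    (ShG.hasContinuousCoeff_refinedSum hF hε G).isWellDefined,
    fun φ _ _ => ShG.pair_eq_of_restrict_eq
      (ShG.restrict_Gtot_eq_restrict_refinedSum hk hr hF hε G) φ⟩
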